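/- **Setting.** Let $\mathbb{R}^n$ be split into $s$ blocks, $\mathbf{x}=(\mathbf{x}_1,\dots,\mathbf{x}_s)$, with the Euclidean norm, and let $$F(\mathbf{x})=f(\mathbf{x})+\sum_{i=1}^s r_i(\mathbf{x}_i),$$ where $f:\mathbb{R}^n\to\mathbb{R}$ is continuously differentiable and each $r_i$ is proper and lower semicontinuous with values in $(-\infty,+\infty]$; no convexity is assumed. The Fréchet subdifferential $\hat\partial F(\mathbf{x})$ at a point of $\mathrm{dom}\,F=\{F<+\infty\}$ is the set of $\mathbf{g}$ with $\liminf_{\mathbf{y}\to\mathbf{x},\,\mathbf{y}\ne\mathbf{x}}\frac{F(\mathbf{y})-F(\mathbf{x})-\langle \mathbf{g},\mathbf{y}-\mathbf{x}\rangle}{\|\mathbf{y}-\mathbf{x}\|}\ge 0$; the limiting subdifferential $\partial F(\mathbf{x})$ is the set of limits of $\mathbf{g}_m\in\hat\partial F(\mathbf{x}_m)$ with $\mathbf{x}_m\to\mathbf{x}$ and $F(\mathbf{x}_m)\to F(\mathbf{x})$; both are empty outside $\mathrm{dom}\,F$, and $\mathrm{dom}(\partial F)=\{\mathbf{x}:\partial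 F(\mathbf{x})\ne\emptyset\}$. **Algorithm (block prox-linear method).** From $\mathbf{x}^0$, at iteration $k=1,2,\dots$ a block $i=b_k$ is selected, the other blocks are kept, and $$\mathbf{x}_i^k\in\operatorname*{argmin}_{\mathbf{u}}\ \langle\nabla_{\mathbf{x}_i}f(\mathbf{x}_{\ne i}^{k-1},\hat{\mathbf{x}}_i^k),\mathbf{u}-\hat{\mathbf{x}}_i^k\rangle+\frac1{2\alpha_k}\|\mathbf{u}-\hat{\mathbf{x}}_i^k\|^2+r_i(\mathbf{u}),\qquad \hat{\mathbf{x}}_i^k=\mathbf{x}_i^{k-1}+\omega_k(\mathbf{x}_i^{k-1}-\mathbf{x}_i^{\mathrm{prev}}),$$ where $\mathbf{x}_i^{\mathrm{prev}}$ is the value of block $i$ before it was last updated (to $\mathbf{x}_i^{k-1}$), and $\mathbf{x}_i^{\mathrm{prev}}=\mathbf{x}_i^0$ if it has not been updated before. **Assumptions.** 1. $F$ is proper and bounded below, and it has a critical point (a point $\mathbf{x}^*$ with $\mathbf{0}\in\partial F(\mathbf{x}^*)$). 2. For every $k\ge1$, with $i=b_k$, $\|\nabla_{\mathbf{x}_i}f(\mathbf{x}_{\ne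 i}^{k-1},\mathbf{u})-\nabla_{\mathbf{x}_i}f(\mathbf{x}_{\ne i}^{k-1},\mathbf{v})\|\le L_k\|\mathbf{u}-\mathbf{v}\|$ for all $\mathbf{u},\mathbf{v}$, and $0<\ell\le L_k\le L<\infty$ for all $k$. 3. For some $T$, within any $T$ consecutive iterations every block is updated at least once. 4. $\alpha_k=\frac1{2L_k}$ and $0\le\omega_k\le1$; moreover there is $\delta<1$ such that $\omega_k\le\frac{\delta}{6}\sqrt{L_p/L_k}$ whenever the block $b_k$ was updated before iteration $k$, where $p<k$ is the iteration of its last such update. 5. $F(\mathbf{x}^k)\le F(\mathbf{x}^{k-1})$ for all $k\ge1$. 6. $\{\mathbf{x}^k\}$ has a limit point $\bar{\mathbf{x}}$. 7. $F$ has the Kurdyka–Łojasiewicz property at $\bar{\mathbf{x}}$ with exponent $\theta\in[0,1)$: $\bar{\mathbf{x}}\in\mathrm{dom}(\partial F)$, and there are $\rho,\eta,c>0$ such that, with $\phi(a)=c\,a^{1-\theta}$, $$\phi'\big(|F(\mathbf{x})-F(\bar{\mathbf{x}})|\big)\,\mathrm{dist}(\mathbf{0},\partial F(\mathbf{x}))\ge1$$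 for all $\mathbf{x}\in\mathrm{dom}(\partial F)$ with $\|\mathbf{x}-\bar{\mathbf{x}}\|<\rho$ and $F(\bar{\mathbf{x}})<F(\mathbf{x})<F(\bar{\mathbf{x}})+\eta$. 8. For each $i$, $\nabla_{\mathbf{x}_i}f$ is Lipschitz continuous on the ball $\{\mathbf{x}:\|\mathbf{x}-\bar{\mathbf{x}}\|<4\rho\}$. **Theorem (convergence rate).** 1. If $\theta\in[0,\frac12]$, there are $C>0$ and $\alpha\in[0,1)$ with $\|\mathbf{x}^k-\bar{\mathbf{x}}\|\le C\alpha^k$ for all $k\ge0$. 2. If $\theta\in(\frac12,1)$, there is $C>0$ with $\|\mathbf{x}^k-\bar{\mathbf{x}}\|\le C\,k^{-(1-\theta)/(2\theta-1)}$ for all $k\ge1$. -/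

import Mathlib

open Filter Topology

noncomputable section

/-! ### Subdifferentials and the Kurdyka–Łojasiewicz property -/

section Subdifferential

variable {E : Type*} [NormedAddCommGroup E] [InnerProductSpace ℝ E]

/-- An extended-real-valued function is proper if it never takes the value `-∞` and is
finite somewhere. -/
def IsProper {X : Type*} (ψ : X → EReal) : Prop :=
  (∀ x, ψ x ≠ ⊥) ∧ ∃ x, ψ x < ⊤

/-- The Fréchet subdifferential: `g` is a subgradient at `x ∈ dom ψ` if
`liminf_{y → x, y ≠ x} (ψ y - ψ x - ⟨g, y - x⟩) / ‖y - x‖ ≥ 0`. It is empty outside `dom ψ`. -/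
def frechetSubdiff (ψ : E → EReal) (x : E) : Set E :=
  {g | ψ x < ⊤ ∧
    0 ≤ liminf
      (fun y => (ψ y - ψ x - ((inner ℝ g (y - x) : ℝ) : EReal)) / ((‖y - x‖ : ℝ) : EReal))
      (𝓝[≠] x)}

/-- The limiting Fréchet subdifferential: limits of Fréchet subgradients `g m` at points
`y m → x` with `ψ (y m) → ψ x`. It is empty outside `dom ψ`. -/
def limitingSubdiff (ψ : E → EReal) (x : E) : Set E :=
  {g | ψ x < ⊤ ∧ ∃ (y : ℕ → E) (h : ℕ → E),
    Tendsto y atTop (𝓝 x) ∧ Tendsto (fun m => ψ (y m)) atTop (𝓝 (ψ x)) ∧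
    (∀ m, h m ∈ frechetSubdiff ψ (y m)) ∧ Tendsto h atTop (𝓝 g)}

/-- The domain of the limiting subdifferential. -/
def subdiffDom (ψ : E → EReal) : Set E := {x | (limitingSubdiff ψ x).Nonempty}

/-- `x` is a critical point of `ψ`. -/
def IsCriticalPoint (ψ : E → EReal) (x : E) : Prop := (0 : E) ∈ limitingSubdiff ψ x

/-- The desingularizing function `φ(a) = c * a ^ (1 - θ)`. -/
def klFun (c θ : ℝ) (a : ℝ) : ℝ := c * a ^ (1 - θ)

/-- `ψ` has the Kurdyka–Łojasiewicz property at `xbar` on the ball of radius `ρ`, for the values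
in `(ψ xbar, ψ xbar + η)`, with `φ(a) = c * a ^ (1 - θ)`. (In the inequality both values of `ψ`
are finite as soon as `ψ` is proper.) -/
structure KLProperty (ψ : E → EReal) (xbar : E) (ρ η c θ : ℝ) : Prop where
  mem_dom : xbar ∈ subdiffDom ψ
  rho_pos : 0 < ρ
  eta_pos : 0 < η
  c_pos : 0 < c
  theta_nonneg : 0 ≤ θ
  theta_lt_one : θ < 1
  ineq : ∀ x ∈ Metric.ball xbar ρ ∩ subdiffDom ψ,
    ψ xbar < ψ x → ψ x < ψ xbar + (η : EReal) →
      1 ≤ deriv (klFun c θ) |(ψ x).toReal - (ψ xbar).toReal| *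
        Metric.infDist 0 (limitingSubdiff ψ x)

end Subdifferential

/-! ### The block structure and the objective -/

/-- `ℝⁿ` split into `s` blocks, the `i`-th one of dimension `n i`, with the Euclidean norm. -/
abbrev BlockSpace {s : ℕ} (n : Fin s → ℕ) : Type :=
  PiLp 2 (fun i => EuclideanSpace ℝ (Fin (n i)))

section Blocks

variable {s : ℕ} {n : Fin s → ℕ}

/-- The point `(x_{≠ i}, u)`: `x` with its `i`-th block replaced by `u`. -/
def setBlock (x : BlockSpace n) (i : Fin s) (u : EuclideanSpace ℝ (Fin (n i))) : BlockSpace n :=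
  WithLp.toLp 2 (Function.update x.ofLp i u)

/-- The block gradient `∇_{x_i} f (x)`: the `i`-th block of the gradient of `f` at `x`. -/
def blockGrad (f : BlockSpace n → ℝ) (i : Fin s) (x : BlockSpace n) :
    EuclideanSpace ℝ (Fin (n i)) :=
  (gradient f x) i

/-- The objective `F(x) = f(x₁, …, x_s) + ∑ i, r_i(x_i)`. -/
def objective (f : BlockSpace n → ℝ) (r : (i : Fin s) → EuclideanSpace ℝ (Fin (n i)) → EReal)
    (x : BlockSpace n) : EReal :=
  (f x : EReal) + ∑ i, r i (x i)

/-! ### The block prox-linear method -/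

/-- The last iteration `κ` with `1 ≤ κ ≤ k` at which block `i` was selected, and `0` if there is
none (`b κ` is the block selected at iteration `κ ≥ 1`; `b 0` plays no role). -/
def lastUpdate (b : ℕ → Fin s) (i : Fin s) : ℕ → ℕ
  | 0 => 0
  | k + 1 => if b (k + 1) = i then k + 1 else lastUpdate b i k

/-- The value of block `i` before it was updated to its value `x_i^k`, i.e. before its last update
up to iteration `k`. If there was no such update, this is `x_i^0` (the convention
`x_i^{-1} = x_i^0`; note `0 - 1 = 0` in `ℕ`). -/
def prevBlock (b : ℕ → Fin s) (x : ℕ → BlockSpace n) (i : Fin s) (k : ℕ) :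
    EuclideanSpace ℝ (Fin (n i)) :=
  x (lastUpdate b i k - 1) i

/-- The extrapolated point of the block `i` used at iteration `k + 1`:
`x_i^k + ω_{k+1} (x_i^k - x_i^prev)`. -/
def extrapolated (b : ℕ → Fin s) (ω : ℕ → ℝ) (x : ℕ → BlockSpace n) (i : Fin s) (k : ℕ) :
    EuclideanSpace ℝ (Fin (n i)) :=
  x k i + ω (k + 1) • (x k i - prevBlock b x i k)

/-- The prox-linear surrogate in the block variable `u`: with `y` the current point, `z` the
extrapolated block and `a` the stepsize,
`⟨∇_{x_i} f(y_{≠ i}, z), u - z⟩ + ‖u - z‖² / (2 a) + r_i(u)`. -/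
def surrogate (f : BlockSpace n → ℝ) (r : (i : Fin s) → EuclideanSpace ℝ (Fin (n i)) → EReal)
    (i : Fin s) (y : BlockSpace n) (z : EuclideanSpace ℝ (Fin (n i))) (a : ℝ)
    (u : EuclideanSpace ℝ (Fin (n i))) : EReal :=
  ((inner ℝ (blockGrad f i (setBlock y i z)) (u - z) + 1 / (2 * a) * ‖u - z‖ ^ 2 : ℝ) : EReal)
    + r i u

/-- `x` is a sequence of iterates of the block prox-linear method with selected blocks `b`,
stepsizes `α` and extrapolation weights `ω` (all indexed by the iterations `1, 2, …`):
at iteration `k + 1` only the block `b (k + 1)` changes, and its new value is a minimizer of the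
surrogate. -/
def IsBPLSequence (f : BlockSpace n → ℝ)
    (r : (i : Fin s) → EuclideanSpace ℝ (Fin (n i)) → EReal)
    (b : ℕ → Fin s) (α ω : ℕ → ℝ) (x : ℕ → BlockSpace n) : Prop :=
  ∀ k : ℕ,
    (∀ i, i ≠ b (k + 1) → x (k + 1) i = x k i) ∧
    ∀ u, surrogate f r (b (k + 1)) (x k) (extrapolated b ω x (b (k + 1)) k) (α (k + 1))
        (x (k + 1) (b (k + 1))) ≤
      surrogate f r (b (k + 1)) (x k) (extrapolated b ω x (b (k + 1)) k) (α (k + 1)) u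

/-- Essentially cyclic updates: within any `T` consecutive iterations among `1, 2, …`, every block
is selected at least once. -/
def EssentiallyCyclic (b : ℕ → Fin s) (T : ℕ) : Prop :=
  ∀ (i : Fin s) (k : ℕ), ∃ κ, k < κ ∧ κ ≤ k + T ∧ b κ = i

/-- The restriction on the extrapolation weights: whenever block `i = b k` has been updated before
iteration `k`, the last time at iteration `p`, then `ω k ≤ (δ / 6) * √(L p / L k)`. (At the first
update of a block the weight has no effect.) -/
def WeightBound (b : ℕ → Fin s) (Lk ω : ℕ → ℝ) (δ : ℝ) : Prop :=
  ∀ k : ℕ, 1 ≤ lastUpdate b (b (k + 1)) k →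
    ω (k + 1) ≤ δ / 6 * √(Lk (lastUpdate b (b (k + 1)) k) / Lk (k + 1))

end Blocks

end

/-!
The proof rests on one Lyapunov function. Write `d_k = ‖x^k - x^{k-1}‖`, and let `p_i(k)` be the
last iteration up to `k` that updated block `i`. Minimality in the prox-linear subproblem and the
descent lemma in the block give, with `i = b k` and `p` the previous update of that block,
`F(x^{k-1}) - F(x^k) ≥ (L_k / 4) d_k² - (δ² / 4) L_p d_p²`
(`realObjective_step_le`, `extrapolation_error_le`). Hence
`Ψ_k = F(x^k) + (δ² / 4) ∑ i, L_{p_i(k)} d_{p_i(k)}²` decreases by at least a constant times `d_k²`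
(`lyapunov_step_le`): the energy of the last updates pays for the extrapolation.

The optimality conditions of the last updates of all the blocks assemble into a Fréchet subgradient
of `F` at `x^k`; near `xbar`, its norm is at most a constant times the length `S_k` of the last `2T`
steps (`norm_gradient_sub_lastStepVector_le`). The same conditions, read as quadratic minorants of
the `r i`, give with lower semicontinuity `F(x^k) → F(xbar)` along a subsequence
(`tendsto_realObjective_comp`), so `a_k = Ψ_k - F(xbar)` decreases to `0`. Since the energy is at
most a constant times `S_k²`, the Kurdyka–Łojasiewicz inequality yields `a_k ^ θ' ≤ C S_k` near
`xbar`, where `θ' = max θ (1 / 2)` (`lyapunov_rpow_le`).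

Everything else takes place in a metric space. Sampling every `M = 2T` steps, sufficient decrease
and the error bound give `S_{k+M} ≤ S_k / 2 + C (a_k ^ (1 - θ') - a_{k+M} ^ (1 - θ'))`
(`step_le_half_add`). Summing traps the iterates near `xbar`, bounds `‖x^k - xbar‖` by a multiple of
`a_{k-M} ^ (1 - θ')`, and gives `a_{k+M} ^ (2θ') ≤ C (a_k - a_{k+M})`
(`exists_trapped_recursion`). This recursion decays geometrically for `θ' = 1 / 2`
(`exists_geometric_bound`) and like `k ^ (-1 / (2θ' - 1))` for `θ' > 1 / 2`
(`exists_reciprocal_growth`).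
-/

noncomputable section

/-! ### Scalar recursions -/

/-- The tangent-line estimate for the concave function `t ↦ t ^ (1 - θ)`, in a form that also
holds at `a = 0`; it is the weighted arithmetic-geometric mean inequality. -/
lemma one_sub_mul_sub_le_rpow_mul {a b θ : ℝ} (ha : 0 ≤ a) (hb : 0 ≤ b) (h0 : 0 ≤ θ)
    (h1 : θ ≤ 1) : (1 - θ) * (a - b) ≤ a ^ θ * (a ^ (1 - θ) - b ^ (1 - θ)) := by
  have h := Real.geom_mean_le_arith_mean2_weighted h0 (sub_nonneg.2 h1) ha hb (by ring)
  have h2 : a ^ θ * a ^ (1 - θ) = a := by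
    rw [← Real.rpow_add_of_nonneg ha h0 (sub_nonneg.2 h1)]; simp
  rw [mul_sub (a ^ θ), h2]
  linarith

/-- One step of the Kurdyka–Łojasiewicz argument: sufficient decrease `D' ^ 2 ≤ C₁ (a - a')` and
the error bound `a ^ θ ≤ C₂ D` make the new step `D'` at most half of the old one plus a
telescoping term. -/
lemma step_le_half_add {a a' D D' θ C₁ C₂ : ℝ} (ha : 0 ≤ a) (ha' : 0 ≤ a')
    (hD : 0 ≤ D) (h0 : 0 ≤ θ) (h1 : θ < 1) (hC₁ : 0 ≤ C₁) (hC₂ : 0 ≤ C₂) (hle : a' ≤ a)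
    (hdec : D' ^ 2 ≤ C₁ * (a - a')) (herr : a ^ θ ≤ C₂ * D) :
    D' ≤ D / 2 + C₁ * C₂ / (2 * (1 - θ)) * (a ^ (1 - θ) - a' ^ (1 - θ)) := by
  set Δ := a ^ (1 - θ) - a' ^ (1 - θ) with hΔ
  have h1' : 0 < 1 - θ := sub_pos.2 h1
  have hΔ0 : 0 ≤ Δ := sub_nonneg.2 (Real.rpow_le_rpow ha' hle h1'.le)
  set c := C₁ * C₂ / (2 * (1 - θ)) with hc
  have hc0 : 0 ≤ c := by positivity
  have hmain : D' ^ 2 ≤ D * (2 * c * Δ) := by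
    have e : 2 * c * (1 - θ) = C₁ * C₂ := by rw [hc]; field_simp
    have h2 : (1 - θ) * D' ^ 2 ≤ (1 - θ) * (D * (2 * c * Δ)) := by
      calc (1 - θ) * D' ^ 2 ≤ (1 - θ) * (C₁ * (a - a')) := by gcongr
        _ = C₁ * ((1 - θ) * (a - a')) := by ring
        _ ≤ C₁ * (a ^ θ * Δ) := by
            exact mul_le_mul_of_nonneg_left (one_sub_mul_sub_le_rpow_mul ha ha' h0 h1.le) hC₁
        _ ≤ C₁ * (C₂ * D * Δ) := by gcongr
        _ = (C₁ * C₂) * (D * Δ) := by ring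
        _ = (1 - θ) * (D * (2 * c * Δ)) := by rw [← e]; ring
    exact le_of_mul_le_mul_left h2 h1'
  refine le_of_sq_le_sq ?_ (by positivity)
  nlinarith [sq_nonneg (D / 2 - c * Δ)]

/-- Summing `step_le_half_add`: all later steps together are controlled by the current step and
the current value. -/
lemma sum_steps_le {A D : ℕ → ℝ} {θ C₁ C₂ : ℝ} (hA : ∀ m, 0 ≤ A m) (hD : ∀ m, 0 ≤ D m)
    (h0 : 0 ≤ θ) (h1 : θ < 1) (hC₁ : 0 ≤ C₁) (hC₂ : 0 ≤ C₂) (hanti : Antitone A)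
    (hdec : ∀ m, D (m + 1) ^ 2 ≤ C₁ * (A m - A (m + 1))) (m N : ℕ)
    (herr : ∀ j, j < N → A (m + j) ^ θ ≤ C₂ * D (m + j)) :
    ∑ j ∈ Finset.range N, D (m + j + 1) ≤ D m + C₁ * C₂ / (1 - θ) * A m ^ (1 - θ) := by
  have h1' : 0 < 1 - θ := sub_pos.2 h1
  set c := C₁ * C₂ / (2 * (1 - θ)) with hc
  have hc0 : 0 ≤ c := by positivity
  have hcc : C₁ * C₂ / (1 - θ) = 2 * c := by rw [hc]; field_simp
  -- the last step and the last value are kept on the left, so that the bound is inductive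
  have key : ∀ N, (∀ j, j < N → A (m + j) ^ θ ≤ C₂ * D (m + j)) →
      ∑ j ∈ Finset.range N, D (m + j + 1) + D (m + N) + 2 * c * A (m + N) ^ (1 - θ)
        ≤ D m + 2 * c * A m ^ (1 - θ) := by
    intro N
    induction N with
    | zero => intro _; simp
    | succ N ih =>
      intro h
      have i1 := ih fun j hj => h j (by omega)
      have i2 := step_le_half_add (hA (m + N)) (hA (m + N + 1)) (hD _) h0 h1 hC₁ hC₂
        (hanti (Nat.le_succ _)) (hdec (m + N)) (h N (by omega))
      rw [← hc] at i2
      rw [Finset.sum_range_succ, ← add_assoc m N 1]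
      linarith
  have := key N herr
  have h3 := hD (m + N)
  have h4 : 0 ≤ 2 * c * A (m + N) ^ (1 - θ) :=
    mul_nonneg (by positivity) (Real.rpow_nonneg (hA _) _)
  rw [hcc]
  linarith

/-- Geometric decay from `A (m + 1) ≤ C (A m - A (m + 1))`. -/
lemma exists_geometric_bound {A : ℕ → ℝ} {C : ℝ} (hC : 0 < C)
    (h : ∀ m, A (m + 1) ≤ C * (A m - A (m + 1))) :
    ∃ q : ℝ, 0 < q ∧ q < 1 ∧ ∀ m, A m ≤ A 0 * q ^ m := by
  refine ⟨C / (1 + C), by positivity, by rw [div_lt_one (by positivity)]; linarith, ?_⟩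
  intro m
  induction m with
  | zero => simp
  | succ m ih =>
    have h1 : A (m + 1) ≤ C / (1 + C) * A m := by
      rw [div_mul_eq_mul_div, le_div_iff₀ (by positivity)]
      linarith [h m]
    calc A (m + 1) ≤ C / (1 + C) * A m := h1
      _ ≤ C / (1 + C) * (A 0 * (C / (1 + C)) ^ m) := by gcongr
      _ = _ := by ring

/-- Polynomial decay from `A (m + 1) ^ (1 + β) ≤ C (A m - A (m + 1))`: the reciprocals
`A m ^ (-β)` grow at least linearly. The conclusion `μ m A m ^ β ≤ 1` says this without
dividing, so that it covers `A m = 0`. -/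
lemma exists_reciprocal_growth {A : ℕ → ℝ} {C β : ℝ} (hA : ∀ m, 0 ≤ A m) (hanti : Antitone A)
    (hC : 0 < C) (hβ0 : 0 < β) (hβ1 : β ≤ 1)
    (h : ∀ m, A (m + 1) ^ (1 + β) ≤ C * (A m - A (m + 1))) :
    ∃ μ : ℝ, 0 < μ ∧ ∀ m : ℕ, μ * m * A m ^ β ≤ 1 := by
  rcases (hA 0).eq_or_lt with hz | hpos
  · refine ⟨1, one_pos, fun m => ?_⟩
    have : A m = 0 := le_antisymm (hz ▸ hanti (Nat.zero_le m)) (hA m)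
    rw [this, Real.zero_rpow hβ0.ne']; simp
  set ν := (2 : ℝ) ^ β - 1 with hν
  have hν0 : 0 < ν := sub_pos.2 (Real.one_lt_rpow one_lt_two hβ0)
  have hA0β : 0 < A 0 ^ β := Real.rpow_pos_of_pos hpos β
  set μ := min (β / (2 * C)) (ν / A 0 ^ β) with hμ
  have hμ0 : 0 < μ := lt_min (by positivity) (by positivity)
  refine ⟨μ, hμ0, fun m => ?_⟩
  induction m with
  | zero => simp
  | succ m ih =>
    rcases (hA (m + 1)).eq_or_lt with hz | hp
    · rw [← hz, Real.zero_rpow hβ0.ne']; simp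
    have hle : A (m + 1) ≤ A m := hanti (Nat.le_succ m)
    have hpm : 0 < A m := hp.trans_le hle
    set u := A m ^ β with hu
    set v := A (m + 1) ^ β with hv
    have hu0 : 0 < u := Real.rpow_pos_of_pos hpm β
    have hv0 : 0 < v := Real.rpow_pos_of_pos hp β
    -- it suffices that the reciprocals differ by at least `μ`
    suffices hs : μ * v * u ≤ u - v by
      push_cast
      have h1 : μ * (m + 1) * v * u ≤ u := by nlinarith
      have h2 : (μ * (m + 1) * v) * u ≤ 1 * u := by linarith
      exact le_of_mul_le_mul_right h2 hu0
    by_cases hcase : A m ≤ 2 * A (m + 1)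
    · have hb : v * A m ≤ u * ((1 - β) * A m + β * A (m + 1)) := by
        have := one_sub_mul_sub_le_rpow_mul (θ := 1 - β) hpm.le hp.le (by linarith) (by linarith)
        have e : A m ^ (1 - β) * u = A m := by
          rw [hu, ← Real.rpow_add hpm]; simp
        rw [sub_sub_cancel, ← hu, ← hv, mul_sub (A m ^ (1 - β)), e] at this
        have h3 : A m ^ (1 - β) * v ≤ (1 - β) * A m + β * A (m + 1) := by linarith
        calc v * A m = v * (A m ^ (1 - β) * u) := by rw [e]
          _ = u * (A m ^ (1 - β) * v) := by ring
          _ ≤ _ := by gcongr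
      have hd : A (m + 1) * v ≤ C * (A m - A (m + 1)) := by
        have := h m
        rwa [Real.rpow_add hp, Real.rpow_one] at this
      have hμ1 : μ * (2 * C) ≤ β := by
        have := min_le_left (β / (2 * C)) (ν / A 0 ^ β)
        rwa [← hμ, le_div_iff₀ (by positivity)] at this
      have h4 : μ * v * u * A m ≤ (u - v) * A m := by
        calc μ * v * u * A m ≤ μ * v * u * (2 * A (m + 1)) := by gcongr
          _ = μ * 2 * u * (A (m + 1) * v) := by ring
          _ ≤ μ * 2 * u * (C * (A m - A (m + 1))) := by gcongr
          _ = (μ * (2 * C)) * (u * (A m - A (m + 1))) := by ring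
          _ ≤ β * (u * (A m - A (m + 1))) :=
              mul_le_mul_of_nonneg_right hμ1 (mul_nonneg hu0.le (sub_nonneg.2 hle))
          _ ≤ (u - v) * A m := by linarith
      exact le_of_mul_le_mul_right h4 hpm
    · push Not at hcase
      have h5 : 2 ^ β * v ≤ u := by
        rw [hu, hv, ← Real.mul_rpow (by norm_num) hp.le]
        exact Real.rpow_le_rpow (by positivity) hcase.le hβ0.le
      have h6 : μ * u ≤ ν := by
        have h7 : μ * A 0 ^ β ≤ ν := by
          have := min_le_right (β / (2 * C)) (ν / A 0 ^ β)
          rwa [← hμ, le_div_iff₀ hA0β] at this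
        have h8 : u ≤ A 0 ^ β :=
          Real.rpow_le_rpow hpm.le (hanti (Nat.zero_le m)) hβ0.le
        nlinarith
      nlinarith

/-! ### Sequences in a metric space with sufficient decrease and an error bound -/

section Metric

variable {X : Type*} [PseudoMetricSpace X]

/-- The length of the path of the sequence `x` over the last `M` steps before index `k`. -/
def windowLength (x : ℕ → X) (M k : ℕ) : ℝ :=
  ∑ j ∈ Finset.Ico (k - M) k, dist (x j) (x (j + 1))

lemma windowLength_nonneg (x : ℕ → X) (M k : ℕ) : 0 ≤ windowLength x M k :=
  Finset.sum_nonneg fun _ _ => dist_nonneg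

lemma dist_le_windowLength (x : ℕ → X) {M k p q : ℕ} (hp : k - M ≤ p) (hp' : p ≤ k)
    (hq : k - M ≤ q) (hq' : q ≤ k) : dist (x p) (x q) ≤ windowLength x M k := by
  wlog h : p ≤ q generalizing p q
  · rw [dist_comm]; exact this hq hq' hp hp' (le_of_not_ge h)
  refine (dist_le_Ico_sum_dist x h).trans ?_
  exact Finset.sum_le_sum_of_subset_of_nonneg (Finset.Ico_subset_Ico hp hq')
    fun _ _ _ => dist_nonneg

lemma windowLength_sq_le {x : ℕ → X} {a : ℕ → ℝ} {σ : ℝ} (hσ : 0 < σ)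
    (hdec : ∀ k, σ * dist (x k) (x (k + 1)) ^ 2 ≤ a k - a (k + 1)) (M k : ℕ) :
    windowLength x M (k + M) ^ 2 ≤ M / σ * (a k - a (k + M)) := by
  have h1 : windowLength x M (k + M) ^ 2 ≤
      M * ∑ j ∈ Finset.Ico k (k + M), dist (x j) (x (j + 1)) ^ 2 := by
    have := sq_sum_le_card_mul_sum_sq (s := Finset.Ico k (k + M))
      (f := fun j => dist (x j) (x (j + 1)))
    simpa [windowLength] using this
  have h2 : ∑ j ∈ Finset.Ico k (k + M), σ * dist (x j) (x (j + 1)) ^ 2 ≤ a k - a (k + M) := by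
    rw [← neg_sub, ← Finset.sum_Ico_sub a (Nat.le_add_right k M), ← Finset.sum_neg_distrib]
    exact Finset.sum_le_sum fun j _ => by linarith [hdec j]
  rw [← Finset.mul_sum] at h2
  refine h1.trans ?_
  rw [div_mul_eq_mul_div, mul_div_assoc]
  gcongr
  rw [le_div_iff₀ hσ]
  linarith

lemma windowLength_shift (x : ℕ → X) {M k : ℕ} (N : ℕ) (hk : M ≤ k) :
    windowLength (fun k => x (k + N)) M k = windowLength x M (k + N) := by
  rw [windowLength, windowLength, show k + N - M = k - M + N by omega,
    ← Finset.sum_Ico_add' (fun j => dist (x j) (x (j + 1))) (k - M) k N]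
  refine Finset.sum_congr rfl fun j _ => ?_
  rw [show j + 1 + N = j + N + 1 by omega]

lemma tendsto_windowLength_zero {x : ℕ → X} {a : ℕ → ℝ} {σ v : ℝ} (hσ : 0 < σ)
    (hdec : ∀ k, σ * dist (x k) (x (k + 1)) ^ 2 ≤ a k - a (k + 1))
    (ha : Tendsto a atTop (𝓝 v)) (M : ℕ) : Tendsto (windowLength x M) atTop (𝓝 0) := by
  rw [← tendsto_add_atTop_iff_nat M]
  have h1 : Tendsto (fun k => √(M / σ * (a k - a (k + M)))) atTop (𝓝 0) := by
    have := ((ha.sub ((tendsto_add_atTop_iff_nat M).2 ha)).const_mul (M / σ)).sqrt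
    simpa using this
  exact squeeze_zero (fun k => windowLength_nonneg _ _ _)
    (fun k => Real.le_sqrt_of_sq_le (windowLength_sq_le hσ hdec M k)) h1

lemma windowLength_le_of_ball {x : ℕ → X} {xbar : X} {ρ : ℝ} {M k : ℕ} (hM : M ≤ k)
    (h : ∀ j, k - M ≤ j → j ≤ k → dist (x j) xbar < ρ) : windowLength x M k ≤ M * (2 * ρ) := by
  have : ∀ j ∈ Finset.Ico (k - M) k, dist (x j) (x (j + 1)) ≤ 2 * ρ := fun j hj => by
    rw [Finset.mem_Ico] at hj
    have h1 := h j hj.1 hj.2.le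
    have h2 := h (j + 1) (by omega) hj.2
    linarith [dist_triangle_right (x j) (x (j + 1)) xbar]
  refine (Finset.sum_le_card_nsmul _ _ _ this).trans_eq ?_
  rw [Nat.card_Ico, Nat.sub_sub_self hM, nsmul_eq_mul]

/-- A sequence with sufficient decrease of `a` that has `xbar` as a cluster point and satisfies
the error bound `a k ^ θ ≤ C₂ * (length of the last M steps)` near `xbar` is trapped near `xbar`.
Along the indices `k₀ + m * M` its values decay recursively, and they control the distance of all
later points to `xbar`. -/
theorem exists_trapped_recursion {x : ℕ → X} {xbar : X} {a : ℕ → ℝ} {σ θ C₂ ρ η : ℝ} {M : ℕ}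
    (hM : 0 < M) (hσ : 0 < σ) (hρ : 0 < ρ) (hη : 0 < η) (hC₂ : 0 ≤ C₂) (hθ : 1 / 2 ≤ θ)
    (hθ1 : θ < 1) (ha : ∀ k, 0 ≤ a k)
    (hdec : ∀ k, σ * dist (x k) (x (k + 1)) ^ 2 ≤ a k - a (k + 1))
    (hlim : Tendsto a atTop (𝓝 0)) (hcl : MapClusterPt xbar atTop x)
    (herr : ∀ k, M ≤ k → (∀ j, k - M ≤ j → j ≤ k → dist (x j) xbar < ρ) → a k < η →
      a k ^ θ ≤ C₂ * windowLength x M k) :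
    ∃ (k₀ : ℕ) (A : ℕ → ℝ) (Cr C : ℝ), 0 < Cr ∧ 0 < C ∧ (∀ m, 0 ≤ A m) ∧ Antitone A ∧
      (∀ m, A (m + 1) ^ (2 * θ) ≤ Cr * (A m - A (m + 1))) ∧
      ∀ m k, k₀ + m * M ≤ k → dist (x k) xbar ≤ C * A m ^ (1 - θ) := by
  have hanti : Antitone a := antitone_nat_of_succ_le fun k => by
    have : 0 ≤ σ * dist (x k) (x (k + 1)) ^ 2 := by positivity
    linarith [hdec k]
  have h1θ : 0 < 1 - θ := sub_pos.2 hθ1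
  set C₁ : ℝ := M / σ with hC₁
  have hC₁0 : 0 < C₁ := by positivity
  set c := C₁ * C₂ / (1 - θ) with hc
  have hc0 : 0 ≤ c := by positivity
  have hcl' : ∀ ε > 0, ∀ N, ∃ k ≥ N, dist (x k) xbar < ε := fun ε hε N => by
    obtain ⟨k, hk, h⟩ := (frequently_atTop.1
      (mapClusterPt_iff_frequently.1 hcl _ (Metric.ball_mem_nhds xbar hε))) N
    exact ⟨k, hk, h⟩
  have hwin : Tendsto (fun k => √(C₁ * a k)) atTop (𝓝 0) := by
    have := (hlim.const_mul C₁).sqrt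
    simpa using this
  have hpow : Tendsto (fun k => c * a k ^ (1 - θ)) atTop (𝓝 0) := by
    have := (hlim.rpow_const (p := 1 - θ) (Or.inr h1θ.le)).const_mul c
    simpa [Real.zero_rpow h1θ.ne'] using this
  have hwinb : ∀ k, windowLength x M (k + M) ≤ √(C₁ * a k) := fun k => by
    refine Real.le_sqrt_of_sq_le ((windowLength_sq_le hσ hdec M k).trans ?_)
    gcongr
    linarith [ha (k + M)]
  -- a starting index after which the whole remaining path has length less than `ρ`
  obtain ⟨N, hN⟩ := eventually_atTop.1
    ((hwin.eventually_lt_const (show (0 : ℝ) < ρ / 4 by positivity)).and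
      ((hpow.eventually_lt_const (show (0 : ℝ) < ρ / 4 by positivity)).and
        ((hlim.eventually_lt_const hη).and (hlim.eventually_lt_const one_pos))))
  obtain ⟨k₁, hk₁, hk₁b⟩ := hcl' (ρ / 4) (by positivity) (N + M)
  set A := fun m => a (k₁ + m * M) with hA
  set D := fun m => windowLength x M (k₁ + m * M) with hD
  have hD0 : ∀ m, 0 ≤ D m := fun m => windowLength_nonneg _ _ _
  have hA0 : ∀ m, 0 ≤ A m := fun m => ha _
  have hAanti : Antitone A := fun m m' h => hanti (by gcongr)
  have hDsq : ∀ m, D (m + 1) ^ 2 ≤ C₁ * (A m - A (m + 1)) := fun m => by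
    have := windowLength_sq_le hσ hdec M (k₁ + m * M)
    have e : k₁ + (m + 1) * M = k₁ + m * M + M := by ring
    simpa only [hD, hA, e] using this
  have hDle : D 0 < ρ / 4 := by
    have h := (hN (k₁ - M) (by omega)).1
    have := hwinb (k₁ - M)
    rw [Nat.sub_add_cancel (by omega)] at this
    simpa [hD] using this.trans_lt h
  have hAle : c * A 0 ^ (1 - θ) < ρ / 4 := by simpa [hA] using (hN k₁ (by omega)).2.1
  have hAη : ∀ m, A m < η := fun m => (hN (k₁ + m * M) (by omega)).2.2.1
  have hA1 : ∀ m, A m < 1 := fun m => (hN (k₁ + m * M) (by omega)).2.2.2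
  -- points reached within `n` windows after window `m`
  have hpath : ∀ m n k, k₁ + m * M ≤ k → k ≤ k₁ + (m + n) * M →
      dist (x (k₁ + m * M)) (x k) ≤ ∑ j ∈ Finset.range n, D (m + j + 1) := by
    intro m n
    induction n with
    | zero =>
      intro k h h'
      rw [Nat.add_zero] at h'
      simp [le_antisymm h' h]
    | succ n ih =>
      intro k h h'
      rw [Finset.sum_range_succ]
      have e : k₁ + (m + n + 1) * M = k₁ + (m + n) * M + M := by ring
      have e' : k₁ + (m + (n + 1)) * M = k₁ + (m + n) * M + M := by ring
      have e'' : k₁ + (m + n) * M = k₁ + m * M + n * M := by ring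
      by_cases hk : k ≤ k₁ + (m + n) * M
      · exact (ih k h hk).trans (le_add_of_nonneg_right (hD0 _))
      · refine (dist_triangle _ (x (k₁ + (m + n) * M)) _).trans (add_le_add (ih _ ?_ le_rfl) ?_)
        · omega
        · exact dist_le_windowLength x (by omega) (by omega) (by omega) (by omega)
  have htrap : ∀ n, (∀ j, j < n → A j ^ θ ≤ C₂ * D j) ∧
      (∀ k, k₁ ≤ k → k ≤ k₁ + n * M → dist (x k) xbar < 3 / 4 * ρ) := by
    intro n
    induction n with
    | zero =>
      refine ⟨fun j hj => absurd hj (Nat.not_lt_zero _), fun k h h' => ?_⟩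
      have : k = k₁ := by omega
      rw [this]; linarith
    | succ n ih =>
      have hlast : A n ^ θ ≤ C₂ * D n := by
        refine herr _ (by omega) (fun j hj hj' => ?_) (hAη n)
        by_cases hjk : k₁ ≤ j
        · linarith [ih.2 j hjk hj']
        · -- only the window before `k₁` reaches back beyond `k₁`
          have hn : n = 0 := by
            by_contra hn
            have : M ≤ n * M := Nat.le_mul_of_pos_left M (Nat.pos_of_ne_zero hn)
            omega
          subst hn
          have h1 : dist (x j) (x k₁) ≤ D 0 := by
            simp only [hD, Nat.zero_mul, Nat.add_zero] at hj ⊢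
            exact dist_le_windowLength x hj (by omega) (by omega) le_rfl
          linarith [dist_triangle (x j) (x k₁) xbar]
      have herr' : ∀ j, j < n + 1 → A j ^ θ ≤ C₂ * D j := fun j hj => by
        rcases Nat.lt_succ_iff_lt_or_eq.1 hj with h | h
        · exact ih.1 j h
        · rw [h]; exact hlast
      refine ⟨herr', fun k h h' => ?_⟩
      have h1 := sum_steps_le hA0 hD0 (by linarith) hθ1 hC₁0.le hC₂ hAanti hDsq 0 (n + 1)
        (fun j hj => by simpa using herr' j hj)
      have h2 := hpath 0 (n + 1) k (by simpa using h) (by simpa using h')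
      rw [Nat.zero_mul, Nat.add_zero, dist_comm] at h2
      linarith [dist_triangle (x k) (x k₁) xbar]
  have herrA : ∀ j, A j ^ θ ≤ C₂ * D j := fun j => (htrap (j + 1)).1 j (Nat.lt_succ_self j)
  have htail : ∀ m k, k₁ + m * M ≤ k → dist (x k) xbar ≤ 2 * (D m + c * A m ^ (1 - θ)) := by
    intro m k hk
    have hall : ∀ k, k₁ + m * M ≤ k →
        dist (x (k₁ + m * M)) (x k) ≤ D m + c * A m ^ (1 - θ) := fun k hk => by
      refine (hpath m k k hk ?_).trans
        (sum_steps_le hA0 hD0 (by linarith) hθ1 hC₁0.le hC₂ hAanti hDsq m k fun j _ => herrA _)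
      have := Nat.le_mul_of_pos_right k hM
      have e : k₁ + (m + k) * M = k₁ + m * M + k * M := by ring
      omega
    refine le_of_forall_pos_le_add fun ε hε => ?_
    obtain ⟨k', hk', hd⟩ := hcl' ε hε (k₁ + m * M)
    have h1 := hall k hk
    have h2 := hall k' hk'
    rw [dist_comm] at h1
    linarith [dist_triangle4 (x k) (x (k₁ + m * M)) (x k') xbar]
  refine ⟨k₁ + M, A, C₂ ^ 2 * C₁ + 1, 2 * (√C₁ + c), by positivity, by positivity, hA0, hAanti,
    fun m => ?_, fun m k hk => ?_⟩
  · have h1 : A (m + 1) ^ (2 * θ) = (A (m + 1) ^ θ) ^ 2 := by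
      rw [mul_comm, Real.rpow_mul (hA0 _)]; norm_num
    have h2 : 0 ≤ A m - A (m + 1) := sub_nonneg.2 (hAanti (Nat.le_succ m))
    calc A (m + 1) ^ (2 * θ) = (A (m + 1) ^ θ) ^ 2 := h1
      _ ≤ (C₂ * D (m + 1)) ^ 2 := by
          have := Real.rpow_nonneg (hA0 (m + 1)) θ
          gcongr
          exact herrA _
      _ = C₂ ^ 2 * D (m + 1) ^ 2 := by ring
      _ ≤ C₂ ^ 2 * (C₁ * (A m - A (m + 1))) := by gcongr; exact hDsq m
      _ ≤ _ := by linarith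
  · have h1 := htail (m + 1) k (by rw [add_mul]; omega)
    have h2 : A (m + 1) ^ (1 - θ) ≤ A m ^ (1 - θ) :=
      Real.rpow_le_rpow (hA0 _) (hAanti (Nat.le_succ m)) h1θ.le
    have h3 : D (m + 1) ≤ √C₁ * A m ^ (1 - θ) := by
      have e : k₁ + (m + 1) * M = k₁ + m * M + M := by ring
      have h4 : D (m + 1) ≤ √(C₁ * A m) := by
        simpa only [hD, hA, e] using hwinb (k₁ + m * M)
      refine h4.trans ?_
      rw [Real.sqrt_mul hC₁0.le, Real.sqrt_eq_rpow (A m)]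
      gcongr ?_ * ?_
      exact Real.rpow_le_rpow_of_exponent_ge' (hA0 m) (hA1 m).le h1θ.le (by linarith)
    have h5 : c * A (m + 1) ^ (1 - θ) ≤ c * A m ^ (1 - θ) := by gcongr
    linarith

end Metric

/-! ### From the recursion to convergence rates -/

/-- Linear rate: one index of `A` is worth `M` indices of `u`, so the geometric ratio of `√A` turns
into its `M`-th root. -/
lemma isBigO_pow_of_recursion {u A : ℕ → ℝ} {k₀ M : ℕ} {Cr C : ℝ} (hM : 0 < M) (hu : ∀ k, 0 ≤ u k)
    (hCr : 0 < Cr) (hC : 0 < C) (hA : ∀ m, 0 ≤ A m)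
    (hrec : ∀ m, A (m + 1) ≤ Cr * (A m - A (m + 1)))
    (hle : ∀ m k, k₀ + m * M ≤ k → u k ≤ C * √(A m)) :
    ∃ q : ℝ, 0 < q ∧ q < 1 ∧ u =O[atTop] fun k => q ^ k := by
  obtain ⟨q, hq0, hq1, hq⟩ := exists_geometric_bound hCr hrec
  -- `A` decays like `q ^ m`, hence `√A` like `√q ^ m`, and one window costs `M` steps
  set p := √q ^ (1 / M : ℝ) with hp
  have hsq : 0 < √q := Real.sqrt_pos.2 hq0
  have hp0 : 0 < p := Real.rpow_pos_of_pos hsq _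
  have hp1 : p < 1 := Real.rpow_lt_one hsq.le (by rw [Real.sqrt_lt' one_pos]; simpa) (by positivity)
  have hpM : p ^ M = √q := by
    rw [hp, ← Real.rpow_natCast, ← Real.rpow_mul hsq.le, one_div,
      inv_mul_cancel₀ (by positivity), Real.rpow_one]
  refine ⟨p, hp0, hp1, ?_⟩
  refine Asymptotics.IsBigO.of_bound (C * √(A 0) / p ^ (k₀ + M)) ?_
  filter_upwards [eventually_ge_atTop k₀] with k hk
  rw [Real.norm_of_nonneg (hu k), Real.norm_of_nonneg (by positivity)]
  set m := (k - k₀) / M with hm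
  have hm1 : m * M ≤ k - k₀ := Nat.div_mul_le_self _ _
  have hm2 : k - k₀ < m * M + M := by
    have := Nat.lt_div_mul_add (a := k - k₀) hM
    simpa [hm] using this
  have h1 := hle m k (by omega)
  have h2 : √(A m) ≤ √(A 0) * p ^ (m * M) := by
    rw [mul_comm m, pow_mul, hpM]
    refine Real.sqrt_le_iff.2 ⟨by positivity, ?_⟩
    rw [mul_pow, Real.sq_sqrt (hA 0), ← pow_mul, mul_comm m 2, pow_mul, Real.sq_sqrt hq0.le]
    exact hq m
  have h3 : p ^ (m * M) * p ^ (k₀ + M) ≤ p ^ k := by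
    rw [← pow_add]
    exact pow_le_pow_of_le_one hp0.le hp1.le (by omega)
  rw [div_mul_eq_mul_div, le_div_iff₀ (by positivity)]
  calc u k * p ^ (k₀ + M) ≤ C * (√(A 0) * p ^ (m * M)) * p ^ (k₀ + M) := by
        gcongr; exact h1.trans (by gcongr)
    _ = C * √(A 0) * (p ^ (m * M) * p ^ (k₀ + M)) := by ring
    _ ≤ _ := by gcongr

/-- Sublinear rate: one index of `A` is worth `M` indices of `u`, which only changes the constant. -/
lemma isBigO_rpow_of_recursion {u A : ℕ → ℝ} {k₀ M : ℕ} {Cr C θ : ℝ} (hM : 0 < M)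
    (hu : ∀ k, 0 ≤ u k) (hθ : 1 / 2 < θ) (hθ1 : θ < 1)
    (hCr : 0 < Cr) (hC : 0 < C) (hA : ∀ m, 0 ≤ A m) (hanti : Antitone A)
    (hrec : ∀ m, A (m + 1) ^ (2 * θ) ≤ Cr * (A m - A (m + 1)))
    (hle : ∀ m k, k₀ + m * M ≤ k → u k ≤ C * A m ^ (1 - θ)) :
    u =O[atTop] fun k : ℕ => (k : ℝ) ^ (-(1 - θ) / (2 * θ - 1)) := by
  have hβ : 0 < 2 * θ - 1 := by linarith
  obtain ⟨μ, hμ, hμA⟩ := exists_reciprocal_growth hA hanti hCr hβ (by linarith)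
    (by simpa using hrec)
  set e := (1 - θ) / (2 * θ - 1) with he
  have he0 : 0 < e := div_pos (by linarith) hβ
  refine Asymptotics.IsBigO.of_bound (C * (μ / (2 * M)) ^ (-e)) ?_
  filter_upwards [eventually_ge_atTop (2 * (k₀ + M))] with k hk
  rw [Real.norm_of_nonneg (hu k), Real.norm_of_nonneg (by positivity)]
  set m := (k - k₀) / M with hm
  have hm1 : m * M ≤ k - k₀ := Nat.div_mul_le_self _ _
  have hm2 : k - k₀ < m * M + M := by
    have := Nat.lt_div_mul_add (a := k - k₀) hM
    simpa [hm] using this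
  have hkm : (k : ℝ) ≤ 2 * M * m := by
    have : k ≤ 2 * (m * M) := by omega
    calc (k : ℝ) ≤ ((2 * (m * M) : ℕ) : ℝ) := by exact_mod_cast this
      _ = _ := by push_cast; ring
  have hk0 : (0 : ℝ) < k := by
    have : 0 < k := by omega
    exact_mod_cast this
  have hz : 0 < μ / (2 * M) * k := by positivity
  have hzm : μ / (2 * M) * k ≤ μ * m := by
    rw [div_mul_eq_mul_div, div_le_iff₀ (by positivity)]
    nlinarith
  have h1 : A m ^ (2 * θ - 1) ≤ (μ / (2 * M) * k)⁻¹ := by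
    rw [← one_div, le_div_iff₀ hz]
    have := hμA m
    have h0 := Real.rpow_nonneg (hA m) (2 * θ - 1)
    nlinarith
  have h2 : A m ^ (1 - θ) ≤ (μ / (2 * M) * k) ^ (-e) := by
    calc A m ^ (1 - θ) = (A m ^ (2 * θ - 1)) ^ e := by
          rw [← Real.rpow_mul (hA m), he, mul_div_cancel₀ _ hβ.ne']
      _ ≤ ((μ / (2 * M) * k)⁻¹) ^ e :=
          Real.rpow_le_rpow (Real.rpow_nonneg (hA m) _) h1 he0.le
      _ = _ := by rw [Real.inv_rpow hz.le, Real.rpow_neg hz.le]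
  rw [neg_div, ← he]
  calc u k ≤ C * A m ^ (1 - θ) := hle m k (by omega)
    _ ≤ C * (μ / (2 * M) * k) ^ (-e) := by gcongr
    _ = _ := by rw [Real.mul_rpow (by positivity) hk0.le, mul_assoc]

/-! ### Finite sums of extended reals -/

section Sums

variable {ι : Type*}

lemma EReal.finsetSum_eq_coe_sum_toReal (s : Finset ι) {φ : ι → EReal} (ht : ∀ i ∈ s, φ i ≠ ⊤)
    (hb : ∀ i ∈ s, φ i ≠ ⊥) : ∑ i ∈ s, φ i = ((∑ i ∈ s, (φ i).toReal : ℝ) : EReal) := by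
  classical
  induction s using Finset.induction_on with
  | empty => simp
  | insert i s hi ih =>
    rw [Finset.sum_insert hi, Finset.sum_insert hi, EReal.coe_add,
      EReal.coe_toReal (ht i (by simp)) (hb i (by simp)),
      ih (fun j hj => ht j (by simp [hj])) (fun j hj => hb j (by simp [hj]))]

lemma EReal.finsetSum_ne_bot (s : Finset ι) {φ : ι → EReal} (hb : ∀ i ∈ s, φ i ≠ ⊥) :
    ∑ i ∈ s, φ i ≠ ⊥ := by
  classical
  induction s using Finset.induction_on with
  | empty => simp
  | insert i s hi ih =>
    rw [Finset.sum_insert hi]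
    simp only [ne_eq, EReal.add_eq_bot_iff, not_or]
    exact ⟨hb i (by simp), ih fun j hj => hb j (by simp [hj])⟩

lemma EReal.finsetSum_eq_top (s : Finset ι) {φ : ι → EReal} (hb : ∀ i ∈ s, φ i ≠ ⊥) {i : ι}
    (hi : i ∈ s) (h : φ i = ⊤) : ∑ i ∈ s, φ i = ⊤ := by
  classical
  rw [← Finset.add_sum_erase s φ hi, h]
  exact EReal.top_add_of_ne_bot
    (EReal.finsetSum_ne_bot _ fun j hj => hb j (Finset.mem_of_mem_erase hj))

end Sums

/-! ### Fréchet subgradients and the descent lemma -/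

section Calculus

variable {E : Type*} [NormedAddCommGroup E] [InnerProductSpace ℝ E]

/-- A minorant that is affine up to an error `o(‖y - x‖)` gives a Fréchet subgradient. -/
lemma mem_frechetSubdiff_of_le {ψ : E → EReal} {x g : E} {a : ℝ} (ha : ψ x = a) {ε : E → ℝ}
    (hε : ε =o[𝓝 x] fun y => y - x)
    (h : ∀ y, ((a + inner ℝ g (y - x) - ε y : ℝ) : EReal) ≤ ψ y) : g ∈ frechetSubdiff ψ x := by
  refine ⟨ha ▸ EReal.coe_lt_top a, ?_⟩
  -- bounding the lower limit by every negative real also covers the trivial filter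
  refine le_of_forall_lt_imp_le_of_dense fun c hc => ?_
  obtain ⟨d, hcd, hd0⟩ := EReal.lt_iff_exists_real_btwn.1 hc
  refine hcd.le.trans (le_liminf_of_le (by isBoundedDefault) ?_)
  have hd : 0 < -d := by
    have : d < 0 := by exact_mod_cast hd0
    linarith
  have h1 : ∀ᶠ y in 𝓝[≠] x, ‖ε y‖ ≤ -d * ‖y - x‖ := (hε.bound hd).filter_mono nhdsWithin_le_nhds
  filter_upwards [h1, self_mem_nhdsWithin] with y hy hyx
  have hpos : 0 < ‖y - x‖ := norm_pos_iff.2 (sub_ne_zero.2 hyx)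
  have h2 : ((-ε y : ℝ) : EReal) ≤ ψ y - ψ x - ((inner ℝ g (y - x) : ℝ) : EReal) := by
    rw [ha]
    calc ((-ε y : ℝ) : EReal)
        = ((a + inner ℝ g (y - x) - ε y : ℝ) : EReal) - (a : EReal)
            - ((inner ℝ g (y - x) : ℝ) : EReal) := by
          rw [← EReal.coe_sub, ← EReal.coe_sub]; congr 1; ring
      _ ≤ _ := EReal.sub_le_sub (EReal.sub_le_sub (h y) le_rfl) le_rfl
  calc (d : EReal) ≤ ((-ε y / ‖y - x‖ : ℝ) : EReal) := by
        rw [EReal.coe_le_coe_iff, le_div_iff₀ hpos]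
        have := (abs_le.1 (Real.norm_eq_abs _ ▸ hy)).2
        linarith
    _ = ((-ε y : ℝ) : EReal) / ((‖y - x‖ : ℝ) : EReal) := EReal.coe_div _ _
    _ ≤ _ := EReal.div_le_div_right_of_nonneg (by exact_mod_cast hpos.le) h2

lemma frechetSubdiff_subset_limitingSubdiff (ψ : E → EReal) (x : E) :
    frechetSubdiff ψ x ⊆ limitingSubdiff ψ x := fun g hg =>
  ⟨hg.1, fun _ => x, fun _ => g, tendsto_const_nhds, tendsto_const_nhds, fun _ => hg,
    tendsto_const_nhds⟩

/-- The descent lemma along the segment from `X` to `X + h`. -/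
lemma le_add_inner_gradient_add [CompleteSpace E] {f : E → ℝ} (hf : Differentiable ℝ f) {X h : E}
    {K : ℝ} (hK : ∀ t : ℝ, 0 ≤ t → t ≤ 1 →
      inner ℝ (gradient f (X + t • h)) h ≤ inner ℝ (gradient f X) h + K * t) :
    f (X + h) ≤ f X + inner ℝ (gradient f X) h + K / 2 := by
  set φ : ℝ → ℝ := fun t => f (X + t • h) - inner ℝ (gradient f X) h * t - K / 2 * t ^ 2 with hφ
  have hder : ∀ t, HasDerivAt φ
      (inner ℝ (gradient f (X + t • h)) h - inner ℝ (gradient f X) h - K * t) t := by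
    intro t
    have h1 : HasDerivAt (fun t : ℝ => X + t • h) h t := by
      simpa using ((hasDerivAt_id t).smul_const h).const_add X
    have h2 : HasDerivAt (fun t : ℝ => f (X + t • h)) (inner ℝ (gradient f (X + t • h)) h) t := by
      have := (hf (X + t • h)).hasFDerivAt.comp_hasDerivAt t h1
      rwa [← inner_gradient_left] at this
    exact ((h2.sub ((hasDerivAt_id t).const_mul (inner ℝ (gradient f X) h))).sub
      ((hasDerivAt_pow 2 t).const_mul (K / 2))).congr_deriv (by simp; ring)
  have hanti : AntitoneOn φ (Set.Icc 0 1) := by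
    refine antitoneOn_of_deriv_nonpos (convex_Icc 0 1)
      (fun t _ => (hder t).continuousAt.continuousWithinAt)
      (fun t _ => (hder t).differentiableAt.differentiableWithinAt) fun t ht => ?_
    rw [interior_Icc] at ht
    rw [(hder t).deriv]
    linarith [hK t ht.1.le ht.2.le]
  have := hanti (Set.left_mem_Icc.2 zero_le_one) (Set.right_mem_Icc.2 zero_le_one) zero_le_one
  simp only [hφ, one_smul, zero_smul, add_zero] at this
  linarith

end Calculus

/-! ### Block vectors and the objective -/

section BlockLemmas

variable {s : ℕ} {n : Fin s → ℕ}

lemma setBlock_eq_add_single (x : BlockSpace n) (i : Fin s) (u : EuclideanSpace ℝ (Fin (n i))) :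
    setBlock x i u = x + PiLp.single 2 i (u - x i) := by
  ext j k
  by_cases h : j = i
  · subst h; simp [setBlock]
  · simp [setBlock, h]

lemma inner_blockSingle (g : BlockSpace n) (i : Fin s) (v : EuclideanSpace ℝ (Fin (n i))) :
    inner ℝ g (PiLp.single 2 i v : BlockSpace n) = inner ℝ (g i) v := by
  rw [PiLp.inner_apply, Finset.sum_eq_single i]
  · simp
  · intro j _ hj; simp [hj]
  · simp

lemma norm_le_sum_norm_blocks (x : BlockSpace n) : ‖x‖ ≤ ∑ i, ‖x i‖ := by
  refine le_of_sq_le_sq ?_ (by positivity)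
  rw [PiLp.norm_sq_eq_of_L2]
  exact Finset.sum_sq_le_sq_sum_of_nonneg fun i _ => norm_nonneg _

/-- The descent lemma in one block. -/
lemma le_of_blockGrad_lipschitz {f : BlockSpace n → ℝ} (hf : Differentiable ℝ f)
    (x : BlockSpace n) (i : Fin s) {L : ℝ}
    (hL : ∀ u v, ‖blockGrad f i (setBlock x i u) - blockGrad f i (setBlock x i v)‖ ≤ L * ‖u - v‖)
    (u : EuclideanSpace ℝ (Fin (n i))) :
    f (setBlock x i u) ≤ f x + inner ℝ (blockGrad f i x) (u - x i) + L / 2 * ‖u - x i‖ ^ 2 := by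
  have hx : setBlock x i (x i) = x := by rw [setBlock_eq_add_single]; simp
  have h := le_add_inner_gradient_add hf (X := x)
    (h := PiLp.single 2 i (u - x i)) (K := L * ‖u - x i‖ ^ 2) fun t ht _ => by
      have e : x + t • (PiLp.single 2 i (u - x i) : BlockSpace n) =
          setBlock x i (x i + t • (u - x i)) := by
        rw [setBlock_eq_add_single, add_sub_cancel_left]
        ext j k
        by_cases h : j = i
        · subst h; simp
        · simp [h]
      rw [e, inner_blockSingle, inner_blockSingle]
      have h1 := hL (x i + t • (u - x i)) (x i)
      rw [hx, add_sub_cancel_left, norm_smul, Real.norm_of_nonneg ht] at h1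
      have h2 := real_inner_le_norm (blockGrad f i (setBlock x i (x i + t • (u - x i)))
        - blockGrad f i x) (u - x i)
      rw [inner_sub_left] at h2
      have h3 := mul_le_mul_of_nonneg_right h1 (norm_nonneg (u - x i))
      simp only [blockGrad] at *
      nlinarith
  rw [← setBlock_eq_add_single, inner_blockSingle] at h
  simp only [blockGrad]
  linarith

variable {f : BlockSpace n → ℝ} {r : (i : Fin s) → EuclideanSpace ℝ (Fin (n i)) → EReal}

/-- The real value of the objective at a point of its domain (`⊤` values of the `r i` are
replaced by `0`). -/
def realObjective (f : BlockSpace n → ℝ)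
    (r : (i : Fin s) → EuclideanSpace ℝ (Fin (n i)) → EReal) (x : BlockSpace n) : ℝ :=
  f x + ∑ i, (r i (x i)).toReal

lemma objective_eq_coe (hr : ∀ i, IsProper (r i)) {x : BlockSpace n} (hx : ∀ i, r i (x i) ≠ ⊤) :
    objective f r x = (realObjective f r x : EReal) := by
  rw [objective, realObjective, EReal.finsetSum_eq_coe_sum_toReal _ (fun i _ => hx i)
    (fun i _ => (hr i).1 _), EReal.coe_add]

lemma objective_eq_top (hr : ∀ i, IsProper (r i)) {x : BlockSpace n} {i : Fin s}
    (hx : r i (x i) = ⊤) : objective f r x = ⊤ := by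
  rw [objective, EReal.finsetSum_eq_top _ (fun i _ => (hr i).1 _) (Finset.mem_univ i) hx]
  exact EReal.add_top_of_ne_bot (EReal.coe_ne_bot _)

/-- A blockwise quadratic minorant of the `r i` at `x` gives a Fréchet subgradient of the
objective. -/
lemma gradient_sub_mem_frechetSubdiff (hr : ∀ i, IsProper (r i)) {x : BlockSpace n}
    (hf : DifferentiableAt ℝ f x) (hx : ∀ i, r i (x i) ≠ ⊤) {v : BlockSpace n} {C : ℝ}
    (h : ∀ i u, r i u ≠ ⊤ → (r i (x i)).toReal ≤
      (r i u).toReal + inner ℝ (v i) (u - x i) + C * ‖u - x i‖ ^ 2) :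
    gradient f x - v ∈ frechetSubdiff (objective f r) x := by
  refine mem_frechetSubdiff_of_le (objective_eq_coe hr hx)
    (ε := fun y => -(f y - f x - inner ℝ (gradient f x) (y - x)) + C * ‖y - x‖ ^ 2) ?_ ?_
  · refine ((hasGradientAt_iff_isLittleO.1 hf.hasGradientAt).neg_left).add ?_
    refine Asymptotics.IsLittleO.const_mul_left ?_ C
    exact (Asymptotics.isLittleO_norm_pow_id one_lt_two).comp_tendsto
      (tendsto_sub_nhds_zero_iff.2 tendsto_id)
  · intro y
    by_cases hy : ∃ i, r i (y i) = ⊤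
    · obtain ⟨i, hi⟩ := hy
      rw [objective_eq_top hr hi]; exact le_top
    push Not at hy
    rw [objective_eq_coe hr hy, EReal.coe_le_coe_iff, realObjective, realObjective]
    have h1 := Finset.sum_le_sum fun i (_ : i ∈ Finset.univ) => h i (y i) (hy i)
    rw [Finset.sum_add_distrib, Finset.sum_add_distrib, ← Finset.mul_sum] at h1
    have h2 : inner ℝ v (y - x) = ∑ i, inner ℝ (v i) (y i - x i) := by
      rw [PiLp.inner_apply]; rfl
    have h3 : ‖y - x‖ ^ 2 = ∑ i, ‖y i - x i‖ ^ 2 := by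
      rw [PiLp.norm_sq_eq_of_L2]; rfl
    rw [inner_sub_left, h2, h3]
    linarith

end BlockLemmas

/-! ### The last update of a block -/

section Updates

variable {s : ℕ} {n : Fin s → ℕ} {b : ℕ → Fin s}

lemma lastUpdate_le (b : ℕ → Fin s) (i : Fin s) (k : ℕ) : lastUpdate b i k ≤ k := by
  induction k with
  | zero => simp [lastUpdate]
  | succ k ih =>
    rw [lastUpdate]
    split_ifs <;> omega

lemma block_lastUpdate_eq {i : Fin s} {k : ℕ} (h : 1 ≤ lastUpdate b i k) :
    b (lastUpdate b i k) = i := by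
  induction k with
  | zero => simp [lastUpdate] at h
  | succ k ih =>
    rw [lastUpdate] at h ⊢
    split_ifs at h ⊢ with hb
    · exact hb
    · exact ih h

lemma le_lastUpdate {i : Fin s} {κ k : ℕ} (h1 : 1 ≤ κ) (hk : κ ≤ k) (hb : b κ = i) :
    κ ≤ lastUpdate b i k := by
  induction k with
  | zero => omega
  | succ k ih =>
    rw [lastUpdate]
    split_ifs with h
    · exact hk
    · refine ih (Nat.lt_succ_iff.1 (lt_of_le_of_ne hk ?_))
      rintro rfl
      exact h hb

lemma lt_lastUpdate_add {T : ℕ} (hT : EssentiallyCyclic b T) (i : Fin s) {k : ℕ} (hk : T ≤ k) :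
    k < lastUpdate b i k + T := by
  obtain ⟨κ, h1, h2, h3⟩ := hT i (k - T)
  have := le_lastUpdate (b := b) (i := i) (k := k) (by omega) (by omega) h3
  omega

lemma apply_lastUpdate {x : ℕ → BlockSpace n} (hx : ∀ k i, i ≠ b (k + 1) → x (k + 1) i = x k i)
    (i : Fin s) (k : ℕ) : x (lastUpdate b i k) i = x k i := by
  induction k with
  | zero => simp [lastUpdate]
  | succ k ih =>
    rw [lastUpdate]
    split_ifs with h
    · rfl
    · rw [ih, hx k i (Ne.symm h)]

/-- In a sum over the last updates of all blocks, iteration `k + 1` replaces one term. -/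
lemma sum_lastUpdate_succ (w : ℕ → ℝ) (k : ℕ) :
    ∑ i, w (lastUpdate b i (k + 1)) =
      ∑ i, w (lastUpdate b i k) + w (k + 1) - w (lastUpdate b (b (k + 1)) k) := by
  rw [← Finset.add_sum_erase _ _ (Finset.mem_univ (b (k + 1))),
    ← Finset.add_sum_erase (a := b (k + 1)) _ (fun i => w (lastUpdate b i k)) (Finset.mem_univ _)]
  have h1 : ∑ i ∈ Finset.univ.erase (b (k + 1)), w (lastUpdate b i (k + 1)) =
      ∑ i ∈ Finset.univ.erase (b (k + 1)), w (lastUpdate b i k) :=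
    Finset.sum_congr rfl fun i hi => by
      rw [lastUpdate, if_neg (Ne.symm (Finset.ne_of_mem_erase hi))]
  rw [h1, lastUpdate, if_pos rfl]
  ring

end Updates

/-! ### One step of the method -/

section Step

variable {s : ℕ} {n : Fin s → ℕ} {f : BlockSpace n → ℝ}
  {r : (i : Fin s) → EuclideanSpace ℝ (Fin (n i)) → EReal}
  {b : ℕ → Fin s} {Lk α ω : ℕ → ℝ} {x : ℕ → BlockSpace n}

/-- The optimality condition of the prox-linear subproblem as a global quadratic minorant:
completing the square turns minimality of the surrogate at `p` into a lower bound for `r i` with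
slope `-(∇ᵢf(y_{≠ i}, z) + 2Λ (p - z))` at `p`. -/
lemma surrogate_minimizer {i : Fin s} (hr : IsProper (r i)) {y : BlockSpace n}
    {z p : EuclideanSpace ℝ (Fin (n i))} {Λ : ℝ} (hΛ : 0 < Λ)
    (h : ∀ u, surrogate f r i y z (1 / (2 * Λ)) p ≤ surrogate f r i y z (1 / (2 * Λ)) u) :
    r i p ≠ ⊤ ∧ ∀ u, r i u ≠ ⊤ → (r i p).toReal ≤ (r i u).toReal +
      inner ℝ (blockGrad f i (setBlock y i z) + (2 * Λ) • (p - z)) (u - p)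
        + Λ * ‖u - p‖ ^ 2 := by
  have hΛ' : 1 / (2 * (1 / (2 * Λ))) = Λ := by field_simp
  simp only [surrogate, hΛ'] at h
  have hp : r i p ≠ ⊤ := by
    obtain ⟨u, hu⟩ := hr.2
    intro htop
    have := h u
    rw [htop, EReal.add_top_of_ne_bot (EReal.coe_ne_bot _), top_le_iff] at this
    exact EReal.add_ne_top (EReal.coe_ne_top _) hu.ne this
  refine ⟨hp, fun u hu => ?_⟩
  have h1 := h u
  rw [← EReal.coe_toReal hp (hr.1 p), ← EReal.coe_toReal hu (hr.1 u), ← EReal.coe_add,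
    ← EReal.coe_add, EReal.coe_le_coe_iff] at h1
  have e : u - z = (u - p) + (p - z) := by abel
  rw [e, norm_add_sq_real, inner_add_right] at h1
  rw [inner_add_left, real_inner_smul_left, real_inner_comm (u - p) (p - z)]
  linarith

/-- The vector `∇ᵢf(x_{≠ i}^k, x̂ᵢ) + 2 L_{k+1} (xᵢ^{k+1} - x̂ᵢ)` of iteration `k + 1`; its negative
is a subgradient of `r i` at the new block. -/
def stepVector (f : BlockSpace n → ℝ) (b : ℕ → Fin s) (Lk ω : ℕ → ℝ) (x : ℕ → BlockSpace n)
    (i : Fin s) (k : ℕ) : EuclideanSpace ℝ (Fin (n i)) :=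
  blockGrad f i (setBlock (x k) i (extrapolated b ω x i k)) +
    (2 * Lk (k + 1)) • (x (k + 1) i - extrapolated b ω x i k)

lemma step_minorant (hr : ∀ i, IsProper (r i)) (hx : IsBPLSequence f r b α ω x) {k : ℕ}
    {i : Fin s} (hi : b (k + 1) = i) (hα : α (k + 1) = 1 / (2 * Lk (k + 1)))
    (hL : 0 < Lk (k + 1)) :
    r i (x (k + 1) i) ≠ ⊤ ∧ ∀ u, r i u ≠ ⊤ → (r i (x (k + 1) i)).toReal ≤ (r i u).toReal +
      inner ℝ (stepVector f b Lk ω x i k) (u - x (k + 1) i)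
        + Lk (k + 1) * ‖u - x (k + 1) i‖ ^ 2 := by
  subst hi
  have h := (hx k).2
  rw [hα] at h
  exact surrogate_minimizer (hr _) hL h

/-- The extrapolation error, weighted by the block Lipschitz constant, is at most `δ² / 4` times
the energy `L_p ‖x^p - x^{p-1}‖²` of the previous update of the block. -/
lemma extrapolation_error_le (hx : IsBPLSequence f r b α ω x) {k : ℕ}
    (hω : 0 ≤ ω (k + 1)) (hL : ∀ k, 1 ≤ k → 0 < Lk k) {δ : ℝ} (hωδ : WeightBound b Lk ω δ) :
    9 * Lk (k + 1) * ‖x k (b (k + 1)) - extrapolated b ω x (b (k + 1)) k‖ ^ 2 ≤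
      δ ^ 2 / 4 * (Lk (lastUpdate b (b (k + 1)) k) *
        dist (x (lastUpdate b (b (k + 1)) k - 1)) (x (lastUpdate b (b (k + 1)) k)) ^ 2) := by
  set i := b (k + 1) with hi
  set p := lastUpdate b i k with hp
  have hxp : x p i = x k i := apply_lastUpdate (fun k i h => (hx k).1 i h) i k
  have hpos := hL (k + 1) (by omega)
  have e : x k i - extrapolated b ω x i k = -(ω (k + 1) • (x p - x (p - 1)) i) := by
    rw [extrapolated, prevBlock, ← hp, ← hxp]
    simp
  have he : ‖x k i - extrapolated b ω x i k‖ ≤ ω (k + 1) * dist (x (p - 1)) (x p) := by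
    rw [e, norm_neg, norm_smul, Real.norm_of_nonneg hω, dist_comm, dist_eq_norm]
    gcongr
    exact PiLp.norm_apply_le _ _
  rcases Nat.eq_zero_or_pos p with h0 | h1
  · -- no earlier update: the extrapolation has no effect
    rw [h0] at he ⊢
    have : ‖x k i - extrapolated b ω x i k‖ = 0 := le_antisymm (by simpa using he) (norm_nonneg _)
    simp [this]
  · have hw := hωδ k h1
    rw [← hi, ← hp] at hw
    have hLp := hL p h1
    have hw2 : ω (k + 1) ^ 2 ≤ δ ^ 2 / 36 * (Lk p / Lk (k + 1)) := by
      calc ω (k + 1) ^ 2 ≤ (δ / 6 * √(Lk p / Lk (k + 1))) ^ 2 := by gcongr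
        _ = _ := by rw [mul_pow, Real.sq_sqrt (by positivity)]; ring
    calc 9 * Lk (k + 1) * ‖x k i - extrapolated b ω x i k‖ ^ 2
        ≤ 9 * Lk (k + 1) * (ω (k + 1) * dist (x (p - 1)) (x p)) ^ 2 := by gcongr
      _ = 9 * Lk (k + 1) * (ω (k + 1) ^ 2 * dist (x (p - 1)) (x p) ^ 2) := by ring
      _ ≤ 9 * Lk (k + 1) * (δ ^ 2 / 36 * (Lk p / Lk (k + 1)) * dist (x (p - 1)) (x p) ^ 2) := by
          gcongr
      _ = _ := by field_simp; ring

lemma dist_step_eq (hx : IsBPLSequence f r b α ω x) (k : ℕ) :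
    dist (x k) (x (k + 1)) = ‖x (k + 1) (b (k + 1)) - x k (b (k + 1))‖ ∧
      x (k + 1) = setBlock (x k) (b (k + 1)) (x (k + 1) (b (k + 1))) := by
  have h : x (k + 1) = setBlock (x k) (b (k + 1)) (x (k + 1) (b (k + 1))) := by
    ext j l
    by_cases hj : j = b (k + 1)
    · subst hj; simp [setBlock]
    · simp [setBlock, hj, (hx k).1 j hj]
  refine ⟨?_, h⟩
  have h2 := setBlock_eq_add_single (x k) (b (k + 1)) (x (k + 1) (b (k + 1)))
  rw [← h] at h2
  rw [dist_comm, dist_eq_norm]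
  conv_lhs => rw [h2]
  rw [add_sub_cancel_left, PiLp.norm_single]

/-- Decrease of the objective in one step, up to the extrapolation error. -/
lemma realObjective_step_le (hf : Differentiable ℝ f) (hr : ∀ i, IsProper (r i))
    (hx : IsBPLSequence f r b α ω x) {k : ℕ}
    (hα : α (k + 1) = 1 / (2 * Lk (k + 1))) (hL : 0 < Lk (k + 1))
    (hLip : ∀ u v, ‖blockGrad f (b (k + 1)) (setBlock (x k) (b (k + 1)) u)
          - blockGrad f (b (k + 1)) (setBlock (x k) (b (k + 1)) v)‖ ≤ Lk (k + 1) * ‖u - v‖)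
    (hfin : r (b (k + 1)) (x k (b (k + 1))) ≠ ⊤) :
    realObjective f r (x (k + 1)) ≤ realObjective f r (x k)
      - Lk (k + 1) / 4 * dist (x k) (x (k + 1)) ^ 2
      + 9 * Lk (k + 1) * ‖x k (b (k + 1)) - extrapolated b ω x (b (k + 1)) k‖ ^ 2 := by
  obtain ⟨hd, hset⟩ := dist_step_eq hx k
  have hmin := (step_minorant hr hx rfl hα hL).2 _ hfin
  have hdesc := le_of_blockGrad_lipschitz hf (x k) (b (k + 1)) hLip (x (k + 1) (b (k + 1)))
  rw [← hset] at hdesc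
  have hsum : ∑ i, (r i (x (k + 1) i)).toReal - (r (b (k + 1)) (x (k + 1) (b (k + 1)))).toReal =
      ∑ i, (r i (x k i)).toReal - (r (b (k + 1)) (x k (b (k + 1)))).toReal := by
    rw [← Finset.add_sum_erase _ _ (Finset.mem_univ (b (k + 1))),
      ← Finset.add_sum_erase (a := b (k + 1)) _ (fun i => (r i (x k i)).toReal)
        (Finset.mem_univ _), add_sub_cancel_left, add_sub_cancel_left]
    exact Finset.sum_congr rfl fun i hi => by rw [(hx k).1 i (Finset.ne_of_mem_erase hi)]
  rw [hd]
  set i := b (k + 1) with hi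
  set z := extrapolated b ω x i k with hz
  have hself : setBlock (x k) i (x k i) = x k := by rw [setBlock_eq_add_single]; simp
  have hgl := hLip (x k i) z
  rw [hself] at hgl
  set g := blockGrad f i (x k) with hg
  set g' := blockGrad f i (setBlock (x k) i z) with hg'
  have hv : stepVector f b Lk ω x i k = g' + (2 * Lk (k + 1)) • (x (k + 1) i - z) := rfl
  rw [hv] at hmin
  set d := x (k + 1) i - x k i with hd'
  set e := x k i - z with he
  have e1 : x (k + 1) i - z = d + e := by rw [hd', he]; abel
  have e2 : x k i - x (k + 1) i = -d := by rw [hd']; abel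
  rw [e1, e2, norm_neg, inner_neg_right, inner_add_left, real_inner_smul_left, inner_add_left,
    real_inner_self_eq_norm_sq] at hmin
  have c1 : inner ℝ (g - g') d ≤ Lk (k + 1) * ‖e‖ * ‖d‖ :=
    (real_inner_le_norm _ _).trans (by gcongr)
  rw [inner_sub_left] at c1
  have c2 : -(‖e‖ * ‖d‖) ≤ inner ℝ e d := (abs_le.1 (abs_real_inner_le_norm e d)).1
  have c3 : 3 * Lk (k + 1) * (‖e‖ * ‖d‖) ≤
      Lk (k + 1) / 4 * ‖d‖ ^ 2 + 9 * Lk (k + 1) * ‖e‖ ^ 2 := by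
    nlinarith [mul_nonneg hL.le (sq_nonneg (‖d‖ / 2 - 3 * ‖e‖))]
  have c4 : 2 * Lk (k + 1) * -(‖e‖ * ‖d‖) ≤ 2 * Lk (k + 1) * inner ℝ e d := by gcongr
  simp only [realObjective]
  linarith

/-- The energy of the most recent updates of all the blocks. The index `0` stands for a block
that has not been updated yet, and contributes `0`. -/
def updateEnergy (b : ℕ → Fin s) (Lk : ℕ → ℝ) (x : ℕ → BlockSpace n) (k : ℕ) : ℝ :=
  ∑ i, Lk (lastUpdate b i k) * dist (x (lastUpdate b i k - 1)) (x (lastUpdate b i k)) ^ 2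

/-- The Lyapunov function: the objective plus `δ² / 4` times the energy of the most recent
updates, which pays for the extrapolation errors to come. -/
def lyapunov (f : BlockSpace n → ℝ) (r : (i : Fin s) → EuclideanSpace ℝ (Fin (n i)) → EReal)
    (b : ℕ → Fin s) (Lk : ℕ → ℝ) (δ : ℝ) (x : ℕ → BlockSpace n) (k : ℕ) : ℝ :=
  realObjective f r (x k) + δ ^ 2 / 4 * updateEnergy b Lk x k

lemma updateEnergy_nonneg (hL : ∀ k, 1 ≤ k → 0 < Lk k) (k : ℕ) : 0 ≤ updateEnergy b Lk x k := by
  refine Finset.sum_nonneg fun i _ => ?_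
  rcases Nat.eq_zero_or_pos (lastUpdate b i k) with h | h
  · simp [h]
  · have := hL _ h
    positivity

lemma lyapunov_step_le (hf : Differentiable ℝ f) (hr : ∀ i, IsProper (r i))
    (hx : IsBPLSequence f r b α ω x) (hα : ∀ k, 1 ≤ k → α k = 1 / (2 * Lk k))
    (hω : ∀ k, 1 ≤ k → 0 ≤ ω k) {l : ℝ} (hl : 0 < l) (hL : ∀ k, 1 ≤ k → l ≤ Lk k)
    {δ : ℝ} (hδ0 : 0 ≤ δ) (hδ1 : δ < 1) (hωδ : WeightBound b Lk ω δ)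
    (hLip : ∀ k : ℕ, ∀ u v, ‖blockGrad f (b (k + 1)) (setBlock (x k) (b (k + 1)) u)
          - blockGrad f (b (k + 1)) (setBlock (x k) (b (k + 1)) v)‖ ≤ Lk (k + 1) * ‖u - v‖)
    {k : ℕ} (hfin : r (b (k + 1)) (x k (b (k + 1))) ≠ ⊤) :
    (1 - δ ^ 2) / 4 * l * dist (x k) (x (k + 1)) ^ 2 ≤
      lyapunov f r b Lk δ x k - lyapunov f r b Lk δ x (k + 1) := by
  have hL0 : ∀ k, 1 ≤ k → 0 < Lk k := fun k hk => hl.trans_le (hL k hk)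
  have h1 := realObjective_step_le hf hr hx (hα (k + 1) (by omega)) (hL0 _ (by omega)) (hLip k) hfin
  have h2 := extrapolation_error_le hx (hω (k + 1) (by omega)) hL0 hωδ (k := k)
  have h3 := sum_lastUpdate_succ (b := b) (fun p => Lk p * dist (x (p - 1)) (x p) ^ 2) k
  simp only [Nat.add_sub_cancel] at h3
  have h4 : (1 - δ ^ 2) / 4 * l * dist (x k) (x (k + 1)) ^ 2 ≤
      (1 - δ ^ 2) / 4 * Lk (k + 1) * dist (x k) (x (k + 1)) ^ 2 := by
    have : 0 ≤ 1 - δ ^ 2 := by nlinarith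
    gcongr
    exact hL _ (by omega)
  simp only [lyapunov, updateEnergy]
  rw [h3]
  nlinarith

end Step

/-! ### Windows of iterations covering all blocks -/

section Window

variable {s : ℕ} {n : Fin s → ℕ} {f : BlockSpace n → ℝ}
  {r : (i : Fin s) → EuclideanSpace ℝ (Fin (n i)) → EReal}
  {b : ℕ → Fin s} {Lk α ω : ℕ → ℝ} {x : ℕ → BlockSpace n} {T : ℕ}

/-- The vector whose block `i` is the `stepVector` of the last update of block `i` up to
iteration `k`. -/
def lastStepVector (f : BlockSpace n → ℝ) (b : ℕ → Fin s) (Lk ω : ℕ → ℝ) (x : ℕ → BlockSpace n)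
    (k : ℕ) : BlockSpace n :=
  WithLp.toLp 2 fun i => stepVector f b Lk ω x i (lastUpdate b i k - 1)

/-- Optimality of the last update of block `i` still describes `r i` at iterate `k`, because the
block has not moved since. -/
lemma lastStepVector_minorant (hr : ∀ i, IsProper (r i)) (hx : IsBPLSequence f r b α ω x)
    (hα : ∀ k, 1 ≤ k → α k = 1 / (2 * Lk k)) {L : ℝ} (hL : ∀ k, 1 ≤ k → 0 < Lk k ∧ Lk k ≤ L)
    (hT : EssentiallyCyclic b T) {k : ℕ} (hk : T ≤ k) (i : Fin s) :
    r i (x k i) ≠ ⊤ ∧ ∀ u, r i u ≠ ⊤ → (r i (x k i)).toReal ≤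
      (r i u).toReal + inner ℝ (lastStepVector f b Lk ω x k i) (u - x k i)
        + L * ‖u - x k i‖ ^ 2 := by
  have hp := lt_lastUpdate_add hT i hk
  have h1 : 1 ≤ lastUpdate b i k := by omega
  have hxp := apply_lastUpdate (fun k i h => (hx k).1 i h) i k
  have hb := block_lastUpdate_eq h1
  obtain ⟨q, hq⟩ : ∃ q, lastUpdate b i k = q + 1 := ⟨_, (Nat.sub_add_cancel h1).symm⟩
  have hv : lastStepVector f b Lk ω x k i = stepVector f b Lk ω x i q := by
    simp [lastStepVector, hq]
  rw [hq] at hxp hb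
  obtain ⟨h2, h3⟩ := step_minorant hr hx hb (hα _ (by omega)) (hL _ (by omega)).1
  rw [hxp] at h2 h3
  refine ⟨h2, fun u hu => (h3 u hu).trans ?_⟩
  rw [hv]
  gcongr
  exact (hL _ (by omega)).2

/-- Near `xbar`, the subgradient `∇f(x^k) - lastStepVector k` of the objective is bounded by the
length of the last `2T` steps: `T` steps reach back to the last update of each block, and `T` more
to the update before it, which enters through the extrapolation. -/
lemma norm_gradient_sub_lastStepVector_le (hx : IsBPLSequence f r b α ω x)
    (hω : ∀ k, 1 ≤ k → 0 ≤ ω k ∧ ω k ≤ 1) {L : ℝ} (hL : ∀ k, 1 ≤ k → 0 < Lk k ∧ Lk k ≤ L)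
    (hT : EssentiallyCyclic b T) {xbar : BlockSpace n} {ρ : ℝ} (hρ : 0 < ρ) {K : Fin s → NNReal}
    (hK : ∀ i, LipschitzOnWith (K i) (blockGrad f i) (Metric.ball xbar (4 * ρ)))
    {k : ℕ} (hk : 2 * T ≤ k) (hball : ∀ j, k - 2 * T ≤ j → j ≤ k → dist (x j) xbar < ρ) :
    ‖gradient f (x k) - lastStepVector f b Lk ω x k‖ ≤
      (∑ i, (2 * K i + 4 * L)) * windowLength x (2 * T) k := by
  refine (norm_le_sum_norm_blocks _).trans ?_
  rw [Finset.sum_mul]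
  refine Finset.sum_le_sum fun i _ => ?_
  set S := windowLength x (2 * T) k with hS
  have hp := lt_lastUpdate_add hT i (k := k) (by omega)
  have hpk := lastUpdate_le b i k
  obtain ⟨q, hq⟩ : ∃ q, lastUpdate b i k = q + 1 :=
    ⟨_, (Nat.sub_add_cancel (show 1 ≤ lastUpdate b i k by omega)).symm⟩
  have hxp := apply_lastUpdate (fun k i h => (hx k).1 i h) i k
  rw [hq] at hp hpk hxp
  have hp' := lt_lastUpdate_add hT i (k := q) (by omega)
  have hpq := lastUpdate_le b i q
  have hxq := apply_lastUpdate (fun k i h => (hx k).1 i h) i q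
  set p := lastUpdate b i q with hpdef
  set z := extrapolated b ω x i q with hz
  have hLq := hL (q + 1) (by omega)
  have hext : ‖x q i - z‖ ≤ dist (x q) (x (p - 1)) := by
    have e : x q i - z = -(ω (q + 1) • (x q - x (p - 1)) i) := by
      rw [hz, extrapolated, prevBlock, ← hpdef]; simp
    have h1 := hω (q + 1) (by omega)
    rw [e, norm_neg, norm_smul, Real.norm_of_nonneg h1.1, dist_eq_norm]
    exact (mul_le_of_le_one_left (norm_nonneg _) h1.2).trans (PiLp.norm_apply_le _ _)
  have hextS : ‖x q i - z‖ ≤ S :=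
    hext.trans (dist_le_windowLength x (by omega) (by omega) (by omega) (by omega))
  set Z := setBlock (x q) i z with hZ
  have hZq : dist (x q) Z = ‖x q i - z‖ := by
    rw [dist_comm, dist_eq_norm, hZ, setBlock_eq_add_single, add_sub_cancel_left,
      PiLp.norm_single, norm_sub_rev]
  have hZball : Z ∈ Metric.ball xbar (4 * ρ) := by
    have h1 := hball q (by omega) (by omega)
    have h2 := hball (p - 1) (by omega) (by omega)
    have h3 := dist_triangle_right (x q) (x (p - 1)) xbar
    have h4 := dist_triangle_left Z xbar (x q)
    rw [Metric.mem_ball]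
    linarith
  have hkball : x k ∈ Metric.ball xbar (4 * ρ) := by
    have := hball k (by omega) le_rfl
    rw [Metric.mem_ball]; linarith
  have hgrad : ‖blockGrad f i (x k) - blockGrad f i Z‖ ≤ K i * (2 * S) := by
    rw [← dist_eq_norm]
    refine ((hK i).dist_le_mul _ hkball _ hZball).trans ?_
    have h1 := dist_le_windowLength x (M := 2 * T) (k := k) (p := k) (q := q) (by omega) le_rfl
      (by omega) (by omega)
    have h2 := dist_triangle (x k) (x q) Z
    gcongr
    linarith
  have hstep : ‖x (q + 1) i - z‖ ≤ 2 * S := by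
    have h1 := dist_le_windowLength x (M := 2 * T) (k := k) (p := q + 1) (q := q) (by omega)
      (by omega) (by omega) (by omega)
    have h2 : ‖x (q + 1) i - x q i‖ ≤ dist (x (q + 1)) (x q) := by
      rw [dist_eq_norm]; exact PiLp.norm_apply_le (x (q + 1) - x q) i
    have h3 := norm_sub_le_norm_sub_add_norm_sub (x (q + 1) i) (x q i) z
    linarith
  have e : (gradient f (x k) - lastStepVector f b Lk ω x k) i =
      (blockGrad f i (x k) - blockGrad f i Z) - (2 * Lk (q + 1)) • (x (q + 1) i - z) := by
    have : lastStepVector f b Lk ω x k i = stepVector f b Lk ω x i q := by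
      simp [lastStepVector, hq]
    rw [PiLp.sub_apply, this, stepVector, sub_add_eq_sub_sub]; rfl
  have hS0 : 0 ≤ S := windowLength_nonneg _ _ _
  calc ‖(gradient f (x k) - lastStepVector f b Lk ω x k) i‖
      ≤ ‖blockGrad f i (x k) - blockGrad f i Z‖ + ‖(2 * Lk (q + 1)) • (x (q + 1) i - z)‖ := by
        rw [e]; exact norm_sub_le _ _
    _ ≤ K i * (2 * S) + 2 * L * (2 * S) := by
        rw [norm_smul, Real.norm_of_nonneg (by linarith)]
        gcongr
        · linarith
        · exact hLq.2
    _ = (2 * K i + 4 * L) * S := by ring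

lemma updateEnergy_le {L : ℝ} (hL : ∀ k, 1 ≤ k → 0 < Lk k ∧ Lk k ≤ L)
    (hT : EssentiallyCyclic b T) {k : ℕ} (hk : 2 * T ≤ k) :
    updateEnergy b Lk x k ≤ s * L * windowLength x (2 * T) k ^ 2 := by
  have h : ∀ i ∈ (Finset.univ : Finset (Fin s)), Lk (lastUpdate b i k) *
      dist (x (lastUpdate b i k - 1)) (x (lastUpdate b i k)) ^ 2 ≤
        L * windowLength x (2 * T) k ^ 2 := fun i _ => by
    have hp := lt_lastUpdate_add hT i (k := k) (by omega)
    have hpk := lastUpdate_le b i k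
    have hLp := hL (lastUpdate b i k) (by omega)
    have := hLp.1.le.trans hLp.2
    gcongr
    · exact hLp.2
    · exact dist_le_windowLength x (by omega) (by omega) (by omega) (by omega)
  refine (Finset.sum_le_card_nsmul _ _ _ h).trans_eq ?_
  rw [Finset.card_univ, Fintype.card_fin, nsmul_eq_mul, mul_assoc]

end Window

/-! ### Consequences of the Kurdyka–Łojasiewicz property -/

section KL

variable {E : Type*} [NormedAddCommGroup E] [InnerProductSpace ℝ E]

lemma deriv_klFun (c θ : ℝ) {a : ℝ} (ha : 0 < a) :
    deriv (klFun c θ) a = c * ((1 - θ) * a ^ (-θ)) := by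
  have h := ((Real.hasDerivAt_rpow_const (p := 1 - θ) (Or.inl ha.ne')).const_mul c).deriv
  have e : (1 - θ - 1 : ℝ) = -θ := by ring
  rw [e] at h
  exact h

/-- The Kurdyka–Łojasiewicz inequality as an error bound in terms of a Fréchet subgradient. -/
lemma KLProperty.rpow_sub_le {ψ : E → EReal} {xbar y g : E} {ρ η c θ u v : ℝ}
    (h : KLProperty ψ xbar ρ η c θ) (hu : ψ xbar = u) (hv : ψ y = v) (hy : dist y xbar < ρ)
    (hlt : u < v) (hη : v < u + η) (hg : g ∈ frechetSubdiff ψ y) :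
    (v - u) ^ θ ≤ c * (1 - θ) * ‖g‖ := by
  have hg' := frechetSubdiff_subset_limitingSubdiff ψ y hg
  have hpos : 0 < v - u := sub_pos.2 hlt
  have h1 := h.ineq y ⟨hy, ⟨g, hg'⟩⟩ (by rw [hu, hv]; exact_mod_cast hlt)
    (by rw [hu, hv]; exact_mod_cast hη)
  rw [hu, hv, EReal.toReal_coe, EReal.toReal_coe, abs_of_pos hpos, deriv_klFun c θ hpos] at h1
  have h2 : Metric.infDist 0 (limitingSubdiff ψ y) ≤ ‖g‖ := by
    simpa using Metric.infDist_le_dist_of_mem (x := (0 : E)) hg'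
  have hθ : 0 < 1 - θ := sub_pos.2 h.theta_lt_one
  have hc := h.c_pos
  have hp : 0 < (v - u) ^ θ := Real.rpow_pos_of_pos hpos θ
  have h3 : 1 ≤ c * ((1 - θ) * ((v - u) ^ θ)⁻¹) * ‖g‖ := by
    rw [Real.rpow_neg hpos.le] at h1
    exact h1.trans (by gcongr)
  calc (v - u) ^ θ ≤ (v - u) ^ θ * (c * ((1 - θ) * ((v - u) ^ θ)⁻¹) * ‖g‖) :=
        le_mul_of_one_le_right hp.le h3
    _ = _ := by field_simp

end KL

/-! ### Convergence of the objective values along a subsequence -/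

section Values

/-- A lower semicontinuous function is continuous along a sequence `y` at whose points it has
quadratic minorants with convergent slopes. -/
lemma tendsto_toReal_of_minorant {H : Type*} [NormedAddCommGroup H] [InnerProductSpace ℝ H]
    {g : H → EReal} (hg : IsProper g) (hlsc : LowerSemicontinuous g) {p w₀ : H} (hp : g p ≠ ⊤)
    {y w : ℕ → H} {L : ℝ} (hy : Tendsto y atTop (𝓝 p)) (hw : Tendsto w atTop (𝓝 w₀))
    (h : ∀ᶠ j in atTop, g (y j) ≠ ⊤ ∧
      (g (y j)).toReal ≤ (g p).toReal + inner ℝ (w j) (p - y j) + L * ‖p - y j‖ ^ 2) :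
    Tendsto (fun j => (g (y j)).toReal) atTop (𝓝 (g p).toReal) := by
  have hd : Tendsto (fun j => p - y j) atTop (𝓝 0) := by simpa using hy.const_sub p
  have hub : Tendsto (fun j => (g p).toReal + inner ℝ (w j) (p - y j) + L * ‖p - y j‖ ^ 2) atTop
      (𝓝 (g p).toReal) := by
    have := ((hw.inner hd).const_add (g p).toReal).add ((hd.norm.pow 2).const_mul L)
    simpa using this
  refine tendsto_order.2 ⟨fun a ha => ?_, fun a ha => ?_⟩
  · have h1 : (a : EReal) < g p := by
      rw [← EReal.coe_toReal hp (hg.1 p)]; exact_mod_cast ha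
    filter_upwards [h, hy.eventually (hlsc p _ h1)] with j hj hj'
    rw [← EReal.coe_toReal hj.1 (hg.1 _)] at hj'
    exact_mod_cast hj'
  · filter_upwards [h, hub.eventually_lt_const ha] with j hj hj'
    exact hj.2.trans_lt hj'

variable {s : ℕ} {n : Fin s → ℕ} {f : BlockSpace n → ℝ}
  {r : (i : Fin s) → EuclideanSpace ℝ (Fin (n i)) → EReal}
  {b : ℕ → Fin s} {Lk α ω : ℕ → ℝ} {x : ℕ → BlockSpace n} {T : ℕ}

/-- The values converge to `F(xbar)` along a subsequence of iterates that tends to `xbar`; at iterate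
`k` the slopes of the minorants are those of the last updates, which tend to `∇f(xbar)`. -/
lemma tendsto_realObjective_comp (hf : ContDiff ℝ 1 f) (hr : ∀ i, IsProper (r i))
    (hlsc : ∀ i, LowerSemicontinuous (r i)) (hx : IsBPLSequence f r b α ω x)
    (hα : ∀ k, 1 ≤ k → α k = 1 / (2 * Lk k)) (hω : ∀ k, 1 ≤ k → 0 ≤ ω k ∧ ω k ≤ 1) {L : ℝ}
    (hL : ∀ k, 1 ≤ k → 0 < Lk k ∧ Lk k ≤ L) (hT : EssentiallyCyclic b T) {xbar : BlockSpace n}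
    (hbar : ∀ i, r i (xbar i) ≠ ⊤) {ρ : ℝ} (hρ : 0 < ρ) {K : Fin s → NNReal}
    (hK : ∀ i, LipschitzOnWith (K i) (blockGrad f i) (Metric.ball xbar (4 * ρ)))
    (hwin : Tendsto (windowLength x (2 * T)) atTop (𝓝 0)) {φ : ℕ → ℕ} (hφ : StrictMono φ)
    (hlim : Tendsto (x ∘ φ) atTop (𝓝 xbar)) :
    Tendsto (fun j => realObjective f r (x (φ j))) atTop (𝓝 (realObjective f r xbar)) := by
  have hwinφ := hwin.comp hφ.tendsto_atTop
  have hgc : Continuous (gradient f) :=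
    (InnerProductSpace.toDual ℝ (BlockSpace n)).symm.continuous.comp
      (hf.continuous_fderiv one_ne_zero)
  have hlarge : ∀ᶠ j in atTop, 2 * T ≤ φ j := hφ.tendsto_atTop.eventually_ge_atTop _
  -- eventually the whole window before `φ j` is close to `xbar`
  have hres : ∀ᶠ j in atTop, ‖gradient f (x (φ j)) - lastStepVector f b Lk ω x (φ j)‖ ≤
      (∑ i, (2 * K i + 4 * L)) * windowLength x (2 * T) (φ j) := by
    have hd : Tendsto (fun j => windowLength x (2 * T) (φ j) + dist (x (φ j)) xbar) atTop (𝓝 0) := by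
      simpa using hwinφ.add (tendsto_iff_dist_tendsto_zero.1 hlim)
    filter_upwards [hlarge, hd.eventually_lt_const hρ] with j hj hj'
    refine norm_gradient_sub_lastStepVector_le hx hω hL hT hρ hK hj fun q hq hq' => ?_
    have := dist_le_windowLength x hq hq' (Nat.sub_le (φ j) (2 * T)) le_rfl
    linarith [dist_triangle (x q) (x (φ j)) xbar]
  have hdiff : Tendsto (fun j => gradient f (x (φ j)) - lastStepVector f b Lk ω x (φ j)) atTop
      (𝓝 0) :=
    squeeze_zero_norm' hres (by simpa using hwinφ.const_mul (∑ i, (2 * (K i : ℝ) + 4 * L)))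
  have hgrad : Tendsto (fun j => gradient f (x (φ j))) atTop (𝓝 (gradient f xbar)) :=
    (hgc.tendsto xbar).comp hlim
  have hvec : Tendsto (fun j => lastStepVector f b Lk ω x (φ j)) atTop (𝓝 (gradient f xbar)) := by
    simpa using hgrad.sub hdiff
  refine ((hf.continuous.tendsto xbar).comp hlim).add (tendsto_finsetSum _ fun i _ => ?_)
  have hcoord : Continuous fun y : BlockSpace n => y i := PiLp.continuous_apply 2 _ i
  refine tendsto_toReal_of_minorant (hr i) (hlsc i) (hbar i) (L := L)
    ((hcoord.tendsto xbar).comp hlim) ((hcoord.tendsto _).comp hvec) ?_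
  filter_upwards [hlarge] with j hj
  have := lastStepVector_minorant hr hx hα hL hT (k := φ j) (by omega) i
  exact ⟨this.1, this.2 _ (hbar i)⟩

end Values

/-! ### The error bound and the recursion for the iterates -/

/-- Combining an error bound for `h` with a quadratic bound for `e`; raising the exponent from `θ`
to `θ' ≥ 1 / 2` is harmless for `h ≤ 1` and makes the quadratic term of lower order. -/
lemma add_rpow_le_mul {h e S R B D θ θ' : ℝ} (h1 : h ≤ 1) (he0 : 0 ≤ e) (hhe : 0 ≤ h + e)
    (hθ : θ ≤ θ') (hθ' : 1 / 2 ≤ θ') (hθ1 : θ' < 1) (hS : 0 ≤ S) (hSR : S ≤ R) (hB : 0 ≤ B)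
    (hD : 0 ≤ D) (he : e ≤ D * S ^ 2) (hh : 0 < h → h ^ θ ≤ B * S) :
    (h + e) ^ θ' ≤ (B + D ^ θ' * R ^ (2 * θ' - 1)) * S := by
  have hθ0 : 0 < θ' := by linarith
  have hS2 : (S ^ 2) ^ θ' = S ^ (2 * θ' - 1) * S := by
    rw [← Real.rpow_natCast, ← Real.rpow_mul hS]
    conv_rhs => rw [← Real.rpow_one S, ← Real.rpow_mul hS, one_mul]
    rw [← Real.rpow_add_of_nonneg hS (by linarith) zero_le_one]
    norm_num
  have h2 : e ^ θ' ≤ D ^ θ' * R ^ (2 * θ' - 1) * S := by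
    calc e ^ θ' ≤ (D * S ^ 2) ^ θ' := Real.rpow_le_rpow he0 he hθ0.le
      _ = D ^ θ' * (S ^ (2 * θ' - 1) * S) := by rw [Real.mul_rpow hD (by positivity), hS2]
      _ ≤ D ^ θ' * (R ^ (2 * θ' - 1) * S) := by
          gcongr
          linarith
      _ = _ := by ring
  have hBS : 0 ≤ B * S := mul_nonneg hB hS
  rw [add_mul]
  rcases lt_or_ge 0 h with hpos | hneg
  · calc (h + e) ^ θ' ≤ h ^ θ' + e ^ θ' :=
          Real.rpow_add_le_add_rpow hpos.le he0 hθ0.le hθ1.le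
      _ ≤ h ^ θ + e ^ θ' :=
          add_le_add_left (Real.rpow_le_rpow_of_exponent_ge hpos h1 hθ) _
      _ ≤ _ := add_le_add (hh hpos) h2
  · calc (h + e) ^ θ' ≤ e ^ θ' := Real.rpow_le_rpow hhe (by linarith) hθ0.le
      _ ≤ _ := by linarith

section Recursion

variable {s : ℕ} {n : Fin s → ℕ} {f : BlockSpace n → ℝ}
  {r : (i : Fin s) → EuclideanSpace ℝ (Fin (n i)) → EReal}
  {b : ℕ → Fin s} {Lk α ω : ℕ → ℝ} {x : ℕ → BlockSpace n} {T : ℕ}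

/-- Near `xbar`, the Kurdyka–Łojasiewicz property bounds the Lyapunov function by the length of
the last `2T` steps. -/
lemma lyapunov_rpow_le (hf : Differentiable ℝ f) (hr : ∀ i, IsProper (r i))
    (hx : IsBPLSequence f r b α ω x)
    (hα : ∀ k, 1 ≤ k → α k = 1 / (2 * Lk k)) (hω : ∀ k, 1 ≤ k → 0 ≤ ω k ∧ ω k ≤ 1) {L : ℝ}
    (hL : ∀ k, 1 ≤ k → 0 < Lk k ∧ Lk k ≤ L) (hT : EssentiallyCyclic b T) {xbar : BlockSpace n}
    (hbar : ∀ i, r i (xbar i) ≠ ⊤) {ρ η c θ θ' : ℝ}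
    (hKL : KLProperty (objective f r) xbar ρ η c θ) {K : Fin s → NNReal}
    (hK : ∀ i, LipschitzOnWith (K i) (blockGrad f i) (Metric.ball xbar (4 * ρ)))
    (hθ : θ ≤ θ') (hθ' : 1 / 2 ≤ θ') (hθ1 : θ' < 1) (δ : ℝ) :
    ∃ C : ℝ, 0 ≤ C ∧ ∀ k, 2 * T ≤ k →
      (∀ j, k - 2 * T ≤ j → j ≤ k → dist (x j) xbar < ρ) →
      0 ≤ lyapunov f r b Lk δ x k - realObjective f r xbar →
      lyapunov f r b Lk δ x k - realObjective f r xbar < min η 1 →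
      (lyapunov f r b Lk δ x k - realObjective f r xbar) ^ θ' ≤
        C * windowLength x (2 * T) k := by
  have hL0 : 0 ≤ L := (hL 1 le_rfl).1.le.trans (hL 1 le_rfl).2
  have hρ := hKL.rho_pos
  have hc := hKL.c_pos
  have hθ1' : 0 < 1 - θ := sub_pos.2 hKL.theta_lt_one
  set G : ℝ := ∑ i, (2 * (K i : ℝ) + 4 * L) with hG
  have hG0 : 0 ≤ G := Finset.sum_nonneg fun i _ => by positivity
  refine ⟨c * (1 - θ) * G + (δ ^ 2 / 4 * (s * L)) ^ θ' *
    ((2 * T : ℕ) * (2 * ρ)) ^ (2 * θ' - 1), by positivity, fun k hk hball h0 hη => ?_⟩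
  have hW0 : 0 ≤ updateEnergy b Lk x k := updateEnergy_nonneg (fun k hk => (hL k hk).1) k
  have hmin := lastStepVector_minorant hr hx hα hL hT (k := k) (by omega)
  have e : lyapunov f r b Lk δ x k - realObjective f r xbar =
      (realObjective f r (x k) - realObjective f r xbar) + δ ^ 2 / 4 * updateEnergy b Lk x k := by
    rw [lyapunov]; ring
  have he0 : 0 ≤ δ ^ 2 / 4 * updateEnergy b Lk x k := by positivity
  rw [e] at h0 hη ⊢
  have hη1 := hη.trans_le (min_le_left η 1)
  have hη2 := hη.trans_le (min_le_right η 1)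
  refine add_rpow_le_mul (by linarith) he0 h0 hθ hθ' hθ1 (windowLength_nonneg _ _ _)
    (windowLength_le_of_ball hk hball) (by positivity) (by positivity) ?_ fun hpos => ?_
  · rw [mul_assoc]
    gcongr
    exact updateEnergy_le hL hT hk
  · have hg := gradient_sub_mem_frechetSubdiff hr (hf (x k)) (fun i => (hmin i).1)
      fun i => (hmin i).2
    refine (hKL.rpow_sub_le (objective_eq_coe hr hbar)
      (objective_eq_coe hr fun i => (hmin i).1) (hball k (by omega) le_rfl) (by linarith)
      (by linarith) hg).trans ?_
    rw [mul_assoc _ G]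
    gcongr
    exact norm_gradient_sub_lastStepVector_le hx hω hL hT hρ hK hk hball

/-- Every block prox-linear sequence satisfying the assumptions of the convergence theorem obeys a
scalar recursion with exponent `θ'`, for every `θ' ≥ θ` in `[1 / 2, 1)`. -/
theorem exists_iterate_recursion (hf : ContDiff ℝ 1 f) (hr : ∀ i, IsProper (r i))
    (hlsc : ∀ i, LowerSemicontinuous (r i)) {m : ℝ} (hm : ∀ y, (m : EReal) ≤ objective f r y)
    (hx : IsBPLSequence f r b α ω x)
    (hα : ∀ k, 1 ≤ k → α k = 1 / (2 * Lk k)) (hω : ∀ k, 1 ≤ k → 0 ≤ ω k ∧ ω k ≤ 1)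
    {δ : ℝ} (hδ0 : 0 ≤ δ) (hδ1 : δ < 1) (hωδ : WeightBound b Lk ω δ)
    (hLip : ∀ k : ℕ, ∀ u v, ‖blockGrad f (b (k + 1)) (setBlock (x k) (b (k + 1)) u)
          - blockGrad f (b (k + 1)) (setBlock (x k) (b (k + 1)) v)‖ ≤ Lk (k + 1) * ‖u - v‖)
    {l L : ℝ} (hl : 0 < l) (hL : ∀ k, 1 ≤ k → l ≤ Lk k ∧ Lk k ≤ L)
    (hT : EssentiallyCyclic b T) {xbar : BlockSpace n} (hxbar : MapClusterPt xbar atTop x)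
    {ρ η c θ θ' : ℝ} (hKL : KLProperty (objective f r) xbar ρ η c θ)
    (hLG : ∀ i, ∃ K : NNReal, LipschitzOnWith K (blockGrad f i) (Metric.ball xbar (4 * ρ)))
    (hθ : θ ≤ θ') (hθ' : 1 / 2 ≤ θ') (hθ1 : θ' < 1) :
    ∃ (k₀ M : ℕ) (A : ℕ → ℝ) (Cr C : ℝ), 0 < M ∧ 0 < Cr ∧ 0 < C ∧ (∀ m, 0 ≤ A m) ∧ Antitone A ∧
      (∀ m, A (m + 1) ^ (2 * θ') ≤ Cr * (A m - A (m + 1))) ∧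
      ∀ m k, k₀ + m * M ≤ k → dist (x k) xbar ≤ C * A m ^ (1 - θ') := by
  choose K hK using hLG
  have hLpos : ∀ k, 1 ≤ k → 0 < Lk k ∧ Lk k ≤ L := fun k hk =>
    ⟨hl.trans_le (hL k hk).1, (hL k hk).2⟩
  have hTpos : 0 < T := by
    obtain ⟨κ, h1, h2, -⟩ := hT (b 0) 0
    omega
  have hbar : ∀ i, r i (xbar i) ≠ ⊤ := fun i hi => by
    obtain ⟨g, hg⟩ := hKL.mem_dom
    exact hg.1.ne (objective_eq_top hr hi)
  have hfin : ∀ k, T ≤ k → ∀ i, r i (x k i) ≠ ⊤ := fun k hk i =>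
    (lastStepVector_minorant hr hx hα hLpos hT hk i).1
  set σ := (1 - δ ^ 2) / 4 * l with hσ
  have hσ0 : 0 < σ := by
    have : 0 < 1 - δ ^ 2 := by nlinarith
    positivity
  -- the iterates and the Lyapunov function, from an index on where all values are finite
  set N := 2 * T with hN
  set y : ℕ → BlockSpace n := fun k => x (k + N) with hy
  set ψ : ℕ → ℝ := fun k => lyapunov f r b Lk δ x (k + N) with hψ
  have hdec : ∀ k, σ * dist (y k) (y (k + 1)) ^ 2 ≤ ψ k - ψ (k + 1) := fun k => by
    have := lyapunov_step_le (hf.differentiable one_ne_zero) hr hx hα (fun k hk => (hω k hk).1) hl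
      (fun k hk => (hL k hk).1) hδ0 hδ1 hωδ hLip (hfin (k + N) (by omega) _)
    simpa only [hy, hψ, hσ, add_right_comm k 1 N] using this
  have hanti : Antitone ψ := antitone_nat_of_succ_le fun k => by
    have : 0 ≤ σ * dist (y k) (y (k + 1)) ^ 2 := by positivity
    linarith [hdec k]
  have hbdd : BddBelow (Set.range ψ) := ⟨m, by
    rintro _ ⟨k, rfl⟩
    have h1 := hm (x (k + N))
    rw [objective_eq_coe hr (hfin _ (by omega)), EReal.coe_le_coe_iff] at h1
    have h2 := updateEnergy_nonneg (b := b) (x := x) (fun k hk => (hLpos k hk).1) (k + N)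
    have : 0 ≤ δ ^ 2 / 4 * updateEnergy b Lk x (k + N) := by positivity
    simp only [hψ, lyapunov]
    linarith⟩
  have hψlim := tendsto_atTop_ciInf hanti hbdd
  have hwin : Tendsto (windowLength x N) atTop (𝓝 0) := by
    rw [← tendsto_add_atTop_iff_nat N]
    refine (tendsto_windowLength_zero hσ0 hdec hψlim N).congr' ?_
    filter_upwards [eventually_ge_atTop N] with k hk
    exact windowLength_shift x N hk
  -- the limit of the Lyapunov function is the objective value at the cluster point
  have hlim : Tendsto ψ atTop (𝓝 (realObjective f r xbar)) := by
    obtain ⟨φ, hφ, hφlim⟩ := hxbar.tendsto_subseq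
    have h1 := tendsto_realObjective_comp hf hr hlsc hx hα hω hLpos hT hbar hKL.rho_pos hK hwin
      hφ hφlim
    have hE : Tendsto (updateEnergy b Lk x) atTop (𝓝 0) := by
      refine squeeze_zero' (.of_forall fun k => updateEnergy_nonneg (fun k hk => (hLpos k hk).1) k)
        ?_ (by simpa using (hwin.pow 2).const_mul (s * L))
      filter_upwards [eventually_ge_atTop N] with k hk
      exact updateEnergy_le hLpos hT hk
    have h2 : Tendsto (fun j => lyapunov f r b Lk δ x (φ j)) atTop
        (𝓝 (realObjective f r xbar)) := by
      simpa [lyapunov] using h1.add ((hE.comp hφ.tendsto_atTop).const_mul (δ ^ 2 / 4))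
    have h3 : Tendsto (lyapunov f r b Lk δ x) atTop (𝓝 (⨅ k, ψ k)) :=
      (tendsto_add_atTop_iff_nat N).1 hψlim
    rwa [tendsto_nhds_unique h2 (h3.comp hφ.tendsto_atTop)]
  have hge : ∀ k, 0 ≤ ψ k - realObjective f r xbar := fun k =>
    sub_nonneg.2 (hanti.le_of_tendsto hlim k)
  have hcl : MapClusterPt xbar atTop y := by
    have : map y atTop = map x atTop := by
      conv_rhs => rw [← map_add_atTop_eq_nat N, Filter.map_map]
      rfl
    rw [MapClusterPt, this]
    exact hxbar
  obtain ⟨C₂, hC₂, herr⟩ := lyapunov_rpow_le (hf.differentiable one_ne_zero) hr hx hα hω hLpos hT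
    hbar hKL hK hθ hθ' hθ1 δ
  obtain ⟨k₀, A, Cr, C, h1, h2, h3, h4, h5, h6⟩ :=
    exists_trapped_recursion (M := N) (a := fun k => ψ k - realObjective f r xbar) (by omega) hσ0
      hKL.rho_pos (lt_min hKL.eta_pos one_pos) hC₂ hθ' hθ1 hge
      (fun k => by simpa using hdec k) (by simpa using hlim.sub_const (realObjective f r xbar)) hcl
      fun k hk hball hη => by
        rw [windowLength_shift x N hk]
        refine herr (k + N) (by omega) (fun j hj hj' => ?_) (hge k) hη
        have := hball (j - N) (by omega) (by omega)
        simpa only [hy, Nat.sub_add_cancel (show N ≤ j by omega)] using this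
  refine ⟨k₀ + N, N, A, Cr, C, by omega, h1, h2, h3, h4, h5, fun q k hk => ?_⟩
  have := h6 q (k - N) (by omega)
  simpa only [hy, Nat.sub_add_cancel (show N ≤ k by omega)] using this

end Recursion

end

/-! ### The convergence rates -/

theorem theorem3 {s : ℕ} {n : Fin s → ℕ}
    (f : BlockSpace n → ℝ) (r : (i : Fin s) → EuclideanSpace ℝ (Fin (n i)) → EReal)
    -- the problem
    (hf : ContDiff ℝ 1 f)
    (hr_proper : ∀ i, IsProper (r i)) (hr_lsc : ∀ i, LowerSemicontinuous (r i))
    (hF_proper : IsProper (objective f r))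
    (hF_bdd : ∃ m : ℝ, ∀ x, (m : EReal) ≤ objective f r x)
    (hF_crit : ∃ x, IsCriticalPoint (objective f r) x)
    -- the iterates, with their stepsizes and weights
    (b : ℕ → Fin s) (Lk α ω : ℕ → ℝ) (x : ℕ → BlockSpace n)
    (hx : IsBPLSequence f r b α ω x)
    (hα : ∀ k, 1 ≤ k → α k = 1 / (2 * Lk k))
    (hω : ∀ k, 1 ≤ k → 0 ≤ ω k ∧ ω k ≤ 1)
    (δ : ℝ) (hδ : δ < 1) (hωδ : WeightBound b Lk ω δ)
    -- block Lipschitz constants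
    (hLip : ∀ k : ℕ, ∀ u v : EuclideanSpace ℝ (Fin (n (b (k + 1)))),
      ‖blockGrad f (b (k + 1)) (setBlock (x k) (b (k + 1)) u)
          - blockGrad f (b (k + 1)) (setBlock (x k) (b (k + 1)) v)‖ ≤ Lk (k + 1) * ‖u - v‖)
    (l L : ℝ) (hl : 0 < l) (hLk : ∀ k, 1 ≤ k → l ≤ Lk k ∧ Lk k ≤ L)
    -- essentially cyclic updates
    (T : ℕ) (hT : EssentiallyCyclic b T)
    -- nonincreasing objective
    (hmono : ∀ k, objective f r (x (k + 1)) ≤ objective f r (x k))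
    -- a limit point with the KL property, and local Lipschitz continuity of the block gradients
    (xbar : BlockSpace n) (hxbar : MapClusterPt xbar atTop x)
    (ρ η c θ : ℝ) (hKL : KLProperty (objective f r) xbar ρ η c θ)
    (hLG : ∀ i, ∃ K : NNReal, LipschitzOnWith K (blockGrad f i) (Metric.ball xbar (4 * ρ))) :
    (θ ≤ 1 / 2 →
      ∃ C a : ℝ, 0 < C ∧ 0 ≤ a ∧ a < 1 ∧ ∀ k : ℕ, ‖x k - xbar‖ ≤ C * a ^ k) ∧
    (1 / 2 < θ →
      ∃ C : ℝ, 0 < C ∧ ∀ k : ℕ, 1 ≤ k →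
        ‖x k - xbar‖ ≤ C * (k : ℝ) ^ (-(1 - θ) / (2 * θ - 1))) := by
  -- a negative `δ` may be replaced by `0`
  have hωδ' : WeightBound b Lk ω (max δ 0) := fun k hk => (hωδ k hk).trans (by
    gcongr
    exact le_max_left _ _)
  obtain ⟨m, hm⟩ := hF_bdd
  have key : ∀ θ', θ ≤ θ' → 1 / 2 ≤ θ' → θ' < 1 → _ := fun θ' h1 h2 h3 =>
    exists_iterate_recursion (θ' := θ') hf hr_proper hr_lsc hm hx hα hω (le_max_right δ 0)
      (max_lt hδ one_pos) hωδ' hLip hl hLk hT hxbar hKL hLG h1 h2 h3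
  refine ⟨fun hθ => ?_, fun hθ => ?_⟩
  · -- for small values, exponents below `1 / 2` are covered by the exponent `1 / 2`
    obtain ⟨k₀, M, A, Cr, C, hM, hCr, hC, hA, -, hrec, hle⟩ := key (1 / 2) hθ le_rfl (by norm_num)
    obtain ⟨q, hq0, hq1, hO⟩ := isBigO_pow_of_recursion (u := fun k => ‖x k - xbar‖) hM
      (fun k => norm_nonneg _) hCr hC hA (fun m => by simpa using hrec m) fun m k hk => by
        have := hle m k hk
        rw [dist_eq_norm, show (1 - 1 / 2 : ℝ) = 1 / 2 by norm_num, ← Real.sqrt_eq_rpow] at this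
        exact this
    obtain ⟨C', hC', hbound⟩ := Asymptotics.bound_of_isBigO_nat_atTop hO
    refine ⟨C', q, hC', hq0.le, hq1, fun k => ?_⟩
    have hpos : 0 < q ^ k := pow_pos hq0 k
    simpa [abs_of_pos hq0] using hbound (x := k) hpos.ne'
  · obtain ⟨k₀, M, A, Cr, C, hM, hCr, hC, hA, hanti, hrec, hle⟩ :=
      key θ le_rfl hθ.le hKL.theta_lt_one
    have hO := isBigO_rpow_of_recursion (u := fun k => ‖x k - xbar‖) hM (fun k => norm_nonneg _) hθ
      hKL.theta_lt_one hCr hC hA hanti hrec fun m k hk => by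
        rw [← dist_eq_norm]; exact hle m k hk
    obtain ⟨C', hC', hbound⟩ := Asymptotics.bound_of_isBigO_nat_atTop hO
    refine ⟨C', hC', fun k hk => ?_⟩
    have hpos : 0 < (k : ℝ) ^ (-(1 - θ) / (2 * θ - 1)) :=
      Real.rpow_pos_of_pos (by exact_mod_cast hk) _
    have := hbound (x := k) hpos.ne'
    rwa [norm_norm, Real.norm_of_nonneg hpos.le] at this
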